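/- Theorem. Let $X$ be an infinite connected simple graph with vertex set $V$, edge set $E$ and graph metric $d$, and suppose that the degrees of the vertices of $X$ are bounded. A finite path $(p(0),\dots,p(n))$ in $X$ (a sequence of consecutively adjacent vertices) is called a $(C,K)$-quasi-geodesic if $j-i\le C\,d(p(i),p(j))+K$ for all $0\le i\le j\le n$, and similarly for bi-infinite paths $\gamma=(\gamma(k))_{k\in\mathbb Z}$. Suppose that $X$ contains a Morse quasi-geodesic $\gamma$, that is, a bi-infinite path which is a $(C_0,K_0)$-quasi-geodesic for some $C_0\ge 1$, $K_0\ge 0$, and such that for all $C\ge 1$ and $K>0$ there is $R$ such that every finite $(C,K)$-quasi-geodesic joining two vertices of $\gamma$ stays in the $R$-neighbourhood of $\gamma$. Let $\nu$ be a probability measure on $[0,\infty)$ with $\int t\,d\nu(t)<\infty$ and $\nu(\{0\})=0$, and let $\omega=(\omega_e)_{e\in E}$ be distributed according to the product measure $\nu^{\otimes E}$ on $[0,\infty)^E$. The $\omega$-length of a finite path is the sum of $\omega_e$ over its edges $e$ (with multiplicity), $d_\omega(x,y)$ is the infimum of the $\omega$-lengths of the finite paths from $x$ to $y$, and an $\omega$-geodesic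 is a finite path whose $\omega$-length equals the $d_\omega$-distance between its endpoints; a bi-infinite $\omega$-geodesic is a bi-infinite path in $X$ all of whose finite subpaths are $\omega$-geodesics. (1) For almost every $\omega$ there is a bi-infinite $\omega$-geodesic. (2) For almost every $\omega$ there is a finite set $A\subset V$ with the following property. Let $(x_n)$ and $(y_n)$ be any sequences of vertices of $\gamma$ that go to infinity on opposite sides of $\gamma$: $x_n=\gamma(i_n)$ and $y_n=\gamma(j_n)$, where one of the integer sequences $(i_n)$, $(j_n)$ tends to $-\infty$ and the other one to $+\infty$. Then for all sufficiently large $n$ there is an $\omega$-geodesic between $x_n$ and $y_n$, and every such $\omega$-geodesic contains a vertex of $A$. -/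

import Mathlib

open MeasureTheory Filter
open scoped NNReal ENNReal

namespace FPP

variable {V : Type*}

/-- A graph has bounded degree if some natural number bounds the number of neighbours of
every vertex. -/
def BoundedDegree (G : SimpleGraph V) : Prop :=
  ∃ q : ℕ, ∀ v : V, (G.neighborSet v).encard ≤ q

/-- A finite path is a walk; it is a `(C, K)`-quasi-geodesic if
`j - i ≤ C * d(p(i), p(j)) + K` for all indices `i ≤ j` of its vertices. -/
def IsQuasiGeodesicWalk (G : SimpleGraph V) (C K : ℝ) {x y : V} (p : G.Walk x y) : Prop :=
  ∀ i j : ℕ, i ≤ j → j ≤ p.length →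
    (j : ℝ) - (i : ℝ) ≤ C * (G.dist (p.getVert i) (p.getVert j) : ℝ) + K

/-- A bi-infinite path of `G`: consecutive vertices are adjacent. -/
def IsBiInfinitePath (G : SimpleGraph V) (γ : ℤ → V) : Prop :=
  ∀ i : ℤ, G.Adj (γ i) (γ (i + 1))

/-- A bi-infinite path that is a `(C, K)`-quasi-geodesic for some `C ≥ 1`, `K ≥ 0`. -/
def IsBiInfiniteQuasiGeodesic (G : SimpleGraph V) (γ : ℤ → V) : Prop :=
  IsBiInfinitePath G γ ∧
    ∃ C K : ℝ, 1 ≤ C ∧ 0 ≤ K ∧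
      ∀ i j : ℤ, i ≤ j → (j : ℝ) - (i : ℝ) ≤ C * (G.dist (γ i) (γ j) : ℝ) + K

/-- The Morse property: for all `C ≥ 1`, `K > 0` there is `R` such that every finite
`(C, K)`-quasi-geodesic with endpoints on `γ` stays in the `R`-neighbourhood of `γ`. -/
def HasMorseProperty (G : SimpleGraph V) (γ : ℤ → V) : Prop :=
  ∀ C K : ℝ, 1 ≤ C → 0 < K → ∃ R : ℝ, ∀ (a b : ℤ) (p : G.Walk (γ a) (γ b)),
    IsQuasiGeodesicWalk G C K p → ∀ v ∈ p.support, ∃ k : ℤ, (G.dist v (γ k) : ℝ) ≤ R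

/-- Morse quasi-geodesics. -/
def IsMorseQuasiGeodesic (G : SimpleGraph V) (γ : ℤ → V) : Prop :=
  IsBiInfiniteQuasiGeodesic G γ ∧ HasMorseProperty G γ

/-- The `ω`-length of a finite path: the sum of the lengths of its edges, counted with
multiplicity. -/
def walkLength {G : SimpleGraph V} (ω : G.edgeSet → ℝ≥0) {x y : V} (p : G.Walk x y) : ℝ≥0 :=
  (p.darts.map fun d => ω ⟨d.edge, d.edge_mem⟩).sum

/-- The first-passage metric `d_ω`: the infimum of the `ω`-lengths of the paths from `x` to `y`. -/
noncomputable def fppDist {G : SimpleGraph V} (ω : G.edgeSet → ℝ≥0) (x y : V) : ℝ≥0 :=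
  ⨅ p : G.Walk x y, walkLength ω p

/-- A finite path is an `ω`-geodesic if its `ω`-length is the `ω`-distance of its endpoints. -/
def IsGeodesic {G : SimpleGraph V} (ω : G.edgeSet → ℝ≥0) {x y : V} (p : G.Walk x y) : Prop :=
  walkLength ω p = fppDist ω x y

/-- A bi-infinite `ω`-geodesic: a bi-infinite path of the graph each of whose finite subpaths
realizes the `ω`-distance between its endpoints. -/
def IsBiInfiniteGeodesic {G : SimpleGraph V} (ω : G.edgeSet → ℝ≥0) (β : ℤ → V) : Prop :=
  ∃ h : IsBiInfinitePath G β, ∀ i j : ℤ, i ≤ j →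
    ∑ k ∈ Finset.Ico i j, ω ⟨s(β k, β (k + 1)), G.mem_edgeSet.2 (h k)⟩ = fppDist ω (β i) (β j)

/-- The law of i.i.d. edge lengths with distribution `ν`: the product measure on
`[0, ∞)^E`. -/
noncomputable def edgeLaw (G : SimpleGraph V) (ν : Measure ℝ≥0) [IsProbabilityMeasure ν] :
    Measure (G.edgeSet → ℝ≥0) :=
  Measure.infinitePi fun _ : G.edgeSet => ν

/-- The pairs `(x n, y n)` of vertices of `γ` go to infinity on opposite sides of `γ`: one of the
two sequences runs to the negative end of `γ` and the other one to the positive end. -/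
def GoToInfinityOnOppositeSides (γ : ℤ → V) (x y : ℕ → V) : Prop :=
  ∃ i j : ℕ → ℤ, (∀ n, x n = γ (i n)) ∧ (∀ n, y n = γ (j n)) ∧
    ((Tendsto i atTop atBot ∧ Tendsto j atTop atTop) ∨
      (Tendsto i atTop atTop ∧ Tendsto j atTop atBot))

end FPP

namespace FPP

/-! ### Geometry of Morse quasi-geodesics: contraction of nearest-point projections. -/

section Geometry

variable {V : Type*} {G : SimpleGraph V}

/-! An `ω`-geodesic joining the two ends of `γ` cannot avoid a large ball around `γ 0`. It would
have to leave a neighbourhood of `γ` for a long excursion; by the Morse property such an excursion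
is far longer than the stretch of `γ` it bypasses, and random edge lengths change the comparison
only by constant factors.

Geometry: nearest-point projection to `γ` is sublinearly contracting (`exists_contraction`). Hence
for every `κ > 0` a path outside a suitable `R`-neighbourhood moves its projection by little more
than `3 * κ` times its length (`exists_dist_proj_le`).

Probability: since `ν {0} = 0`, a Chernoff bound beats the exponential number of trails, so long
trails have `ω`-length at least `c` times their length (`exists_ae_linearGrowth`). Since the mean is
finite, the law of large numbers and Borel–Cantelli bound the `ω`-distance from `γ 0` to the
`R`-neighbours of `γ (±k)` by `L * k` (`exists_ae_eventually_fppDist_le`). As `L` is independent of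
`R`, one may choose `κ` small compared with `c / L` and only then `R`.

Comparison (`exists_forall_isGeodesic_meets_ball`): an excursion from near `γ (-a)` to near `γ b`
has length much larger than `a + b`, so its `ω`-length exceeds `L * (a + b)`, which is impossible
for a geodesic. The ball met by all these geodesics is finite; this gives (2), and a compactness
argument gives (1). -/

theorem dist_getVert_le {x y : V} (p : G.Walk x y) {i j : ℕ} (hij : i ≤ j) :
    G.dist (p.getVert i) (p.getVert j) ≤ j - i := by
  have h := SimpleGraph.dist_le ((p.drop i).take (j - i))
  rw [SimpleGraph.Walk.take_length, SimpleGraph.Walk.drop_getVert, Nat.add_sub_cancel' hij] at h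
  refine h.trans ?_
  exact min_le_left _ _

theorem dist_getVert_eq (hconn : G.Connected) {x y : V} (p : G.Walk x y)
    (hp : p.length = G.dist x y) {i j : ℕ} (hij : i ≤ j) (hj : j ≤ p.length) :
    G.dist (p.getVert i) (p.getVert j) = j - i := by
  refine le_antisymm (dist_getVert_le p hij) ?_
  have h1 := dist_getVert_le p (Nat.zero_le i)
  have h2 := dist_getVert_le p hj
  rw [p.getVert_zero] at h1
  rw [p.getVert_length] at h2
  have h3 := hconn.dist_triangle (u := x) (v := p.getVert i) (w := y)
  have h4 := hconn.dist_triangle (u := p.getVert i) (v := p.getVert j) (w := y)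
  omega

theorem dist_path_le (hconn : G.Connected) {γ : ℤ → V} (hγ : IsBiInfinitePath G γ)
    (i : ℤ) (n : ℕ) : G.dist (γ i) (γ (i + n)) ≤ n := by
  induction n with
  | zero => simp
  | succ n ih =>
    have h1 := hconn.dist_triangle (u := γ i) (v := γ (i + n)) (w := γ (i + (n + 1 : ℕ)))
    have h2 : G.dist (γ (i + n)) (γ (i + (n + 1 : ℕ))) = 1 := by
      rw [SimpleGraph.dist_eq_one_iff_adj]
      have := hγ (i + n)
      rwa [add_assoc] at this
    omega

/-- The vertex `γ k` is a nearest vertex of `γ` to `v`. -/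
def IsNearest (G : SimpleGraph V) (γ : ℤ → V) (v : V) (k : ℤ) : Prop :=
  ∀ j, G.dist v (γ k) ≤ G.dist v (γ j)

theorem exists_isNearest (G : SimpleGraph V) (γ : ℤ → V) (v : V) : ∃ k, IsNearest G γ v k := by
  obtain ⟨k, hk⟩ := exists_minimal_of_wellFoundedLT (fun n => ∃ k, G.dist v (γ k) = n)
    ⟨_, 0, rfl⟩
  obtain ⟨j, hj⟩ := hk.1
  refine ⟨j, fun i => ?_⟩
  by_contra! h
  have := hk.2 ⟨i, rfl⟩ (by omega)
  omega

/-- Points on a geodesic from a nearest vertex of `γ` have the expected distance to `γ`. -/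
theorem le_dist_getVert_of_isNearest (hconn : G.Connected) {γ : ℤ → V} {v : V} {k : ℤ}
    (hk : IsNearest G γ v k) (p : G.Walk (γ k) v) (hp : p.length = G.dist (γ k) v) {s : ℕ}
    (hs : s ≤ p.length) (j : ℤ) : s ≤ G.dist (p.getVert s) (γ j) := by
  have h1 := dist_getVert_eq hconn p hp hs le_rfl
  rw [p.getVert_length] at h1
  have h2 := hconn.dist_triangle (u := v) (v := p.getVert s) (w := γ j)
  have h3 := hk j
  rw [SimpleGraph.dist_comm] at h1
  rw [SimpleGraph.dist_comm (u := γ k)] at hp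
  omega

/-- The concatenation of two geodesics `p`, `q` issuing from far apart vertices of `γ`, cut where
they come relatively close to each other for the first time, with a shortest bridge `m`. -/
theorem isQuasiGeodesicWalk_bridge (hconn : G.Connected) {γ : ℤ → V} {κ C : ℝ} (hκ : 0 < κ)
    (hC7 : 7 ≤ C) (hC : 18 ≤ C * κ) {z w : V} {k l : ℤ} (hw : IsNearest G γ w l)
    (p : G.Walk (γ k) z) (hp : p.length = G.dist (γ k) z)
    (q : G.Walk (γ l) w) (hq : q.length = G.dist (γ l) w)
    (hfar : κ * p.length ≤ G.dist (γ k) (γ l)) {s t : ℕ} (hs : s ≤ p.length) (ht : t ≤ q.length)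
    (m : G.Walk (p.getVert s) (q.getVert t)) (hm : m.length = G.dist (p.getVert s) (q.getVert t))
    (hclose : 2 * m.length ≤ s)
    (hmin : ∀ t' ≤ q.length, m.length ≤ G.dist (p.getVert s) (q.getVert t'))
    (hfirst : ∀ s' < s, ∀ t' ≤ q.length, s' < 2 * G.dist (p.getVert s') (q.getVert t')) :
    IsQuasiGeodesicWalk G C 1 ((p.take s).append (m.append (q.take t).reverse)) := by
  -- The vertex `q t` has distance at least `t` from all of `γ`, but reaches `γ k` through `p s`.
  have hts : t ≤ s + m.length := by
    have h1 := le_dist_getVert_of_isNearest hconn hw q hq ht k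
    have h2 := hconn.dist_triangle (u := q.getVert t) (v := p.getVert s) (w := γ k)
    have h3 := dist_getVert_eq hconn p hp (Nat.zero_le s) hs
    rw [p.getVert_zero, SimpleGraph.dist_comm] at h3
    rw [SimpleGraph.dist_comm] at hm
    omega
  have key : ∀ i j : ℕ, i ≤ j → j ≤ s + m.length + t → ∀ a b : V,
      a = (if i < s then p.getVert i else if i - s < m.length then m.getVert (i - s)
        else q.getVert (t - (i - s - m.length))) →
      b = (if j < s then p.getVert j else if j - s < m.length then m.getVert (j - s)
        else q.getVert (t - (j - s - m.length))) →
      (j : ℝ) - i ≤ C * G.dist a b + 1 := by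
    intro i j hij hj a b ha hb
    -- The two alternatives are absorbed by `7 ≤ C` and `18 ≤ C * κ` respectively.
    suffices h : j - i ≤ 7 * G.dist a b ∨ ((j : ℝ) - i) * κ ≤ 18 * G.dist a b by
      have h0 : (0 : ℝ) ≤ G.dist a b := Nat.cast_nonneg _
      rcases h with h | h
      · have h' : ((j - i : ℕ) : ℝ) ≤ 7 * G.dist a b := by exact_mod_cast h
        rw [Nat.cast_sub hij] at h'
        nlinarith
      · have h2 : ((j : ℝ) - i) * κ ≤ (C * G.dist a b) * κ := by nlinarith
        have := le_of_mul_le_mul_right h2 hκ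
        linarith
    by_cases hi1 : i < s
    · rw [if_pos hi1] at ha
      by_cases hj1 : j < s
      · rw [if_pos hj1] at hb
        left
        rw [ha, hb, dist_getVert_eq hconn p hp hij (by omega)]
        omega
      · rw [if_neg hj1] at hb
        by_cases hj2 : j - s < m.length
        · rw [if_pos hj2] at hb
          left
          -- Write `u = d(a, b)`. Minimality of `s` and `2 * m.length ≤ s` give `j - s < 3u`, hence
          -- `s - i < 4u`; this is the source of the constant 7.
          have h1 := hfirst i hi1 t ht
          have h2 := hconn.dist_triangle (u := a) (v := b) (w := q.getVert t)
          have h3 := dist_getVert_eq hconn m hm hj2.le le_rfl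
          rw [m.getVert_length, ← hb] at h3
          rw [← ha] at h1
          have h4 := dist_getVert_eq hconn m hm (Nat.zero_le _) hj2.le
          rw [m.getVert_zero, ← hb, SimpleGraph.dist_comm] at h4
          have h5 := hconn.dist_triangle (u := a) (v := b) (w := p.getVert s)
          have h6 := dist_getVert_eq hconn p hp hi1.le hs
          rw [← ha] at h6
          omega
        · rw [if_neg hj2] at hb
          -- The only case that uses `hfar`. With `u = d(a, b)` one has `i < 2u` and `t' < 3u`, so
          -- `κ * p.length ≤ d(γ k, γ l) ≤ 6u`, while the whole walk has length at most `3 *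
          -- p.length`.
          right
          obtain ⟨t', ht'⟩ : ∃ t', t' = t - (j - s - m.length) := ⟨_, rfl⟩
          rw [← ht'] at hb
          have h1 := hfirst i hi1 t' (by omega)
          rw [← ha, ← hb] at h1
          have h2 := le_dist_getVert_of_isNearest hconn hw q hq (s := t') (by omega) k
          rw [← hb] at h2
          have h3 := dist_getVert_eq hconn p hp (Nat.zero_le i) (by omega)
          rw [p.getVert_zero, ← ha] at h3
          have h4 := dist_getVert_eq hconn q hq (Nat.zero_le t') (by omega)
          rw [q.getVert_zero, ← hb] at h4
          have h5 := hconn.dist_triangle (u := b) (v := a) (w := γ k)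
          have h6 := hconn.dist_triangle (u := γ k) (v := a) (w := γ l)
          have h7 := hconn.dist_triangle (u := a) (v := b) (w := γ l)
          rw [SimpleGraph.dist_comm (u := b) (v := a), SimpleGraph.dist_comm (u := a) (v := γ k)]
            at h5
          rw [SimpleGraph.dist_comm (u := b) (v := γ l)] at h7
          have h8 : G.dist (γ k) (γ l) ≤ 6 * G.dist a b := by omega
          have h8' : (G.dist (γ k) (γ l) : ℝ) ≤ 6 * G.dist a b := by exact_mod_cast h8
          have h9 : j - i ≤ 3 * p.length := by omega
          have h9' : ((j - i : ℕ) : ℝ) ≤ 3 * p.length := by exact_mod_cast h9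
          rw [Nat.cast_sub hij] at h9'
          nlinarith
    · rw [if_neg hi1] at ha
      rw [if_neg (by omega)] at hb
      left
      by_cases hi2 : i - s < m.length
      · rw [if_pos hi2] at ha
        by_cases hj2 : j - s < m.length
        · rw [if_pos hj2] at hb
          rw [ha, hb, dist_getVert_eq hconn m hm (by omega) (by omega)]
          omega
        · rw [if_neg hj2] at hb
          obtain ⟨t', ht'⟩ : ∃ t', t' = t - (j - s - m.length) := ⟨_, rfl⟩
          rw [← ht'] at hb
          -- As `m` is a shortest bridge to `q`, the rest of `m` after `a` is at most `d(a, b)`.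
          have h1 := hmin t' (by omega)
          rw [← hb] at h1
          have h2 := hconn.dist_triangle (u := p.getVert s) (v := a) (w := b)
          have h3 := dist_getVert_eq hconn m hm (Nat.zero_le _) hi2.le
          rw [m.getVert_zero, ← ha] at h3
          have h4 := dist_getVert_eq hconn m hm hi2.le le_rfl
          rw [m.getVert_length, ← ha] at h4
          have h5 := dist_getVert_eq hconn q hq (i := t') (by omega) ht
          rw [← hb] at h5
          have h6 := hconn.dist_triangle (u := b) (v := a) (w := q.getVert t)
          rw [SimpleGraph.dist_comm (u := b) (v := a)] at h6
          omega
      · rw [if_neg hi2] at ha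
        rw [if_neg (by omega)] at hb
        rw [ha, hb, SimpleGraph.dist_comm, dist_getVert_eq hconn q hq (by omega) (by omega)]
        omega
  have hget : ∀ i : ℕ, i ≤ s + m.length + t →
      ((p.take s).append (m.append (q.take t).reverse)).getVert i =
      (if i < s then p.getVert i else if i - s < m.length then m.getVert (i - s)
        else q.getVert (t - (i - s - m.length))) := by
    intro i hi
    rw [SimpleGraph.Walk.getVert_append, SimpleGraph.Walk.getVert_append,
      SimpleGraph.Walk.getVert_reverse, SimpleGraph.Walk.take_length, SimpleGraph.Walk.take_length,
      SimpleGraph.Walk.take_getVert, SimpleGraph.Walk.take_getVert, min_eq_left hs,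
      min_eq_left ht]
    split_ifs with h1 h2
    · rw [min_eq_right h1.le]
    · rfl
    · rw [min_eq_right (by omega)]
  have hlen : ((p.take s).append (m.append (q.take t).reverse)).length = s + m.length + t := by
    rw [SimpleGraph.Walk.length_append, SimpleGraph.Walk.length_append,
      SimpleGraph.Walk.length_reverse, SimpleGraph.Walk.take_length, SimpleGraph.Walk.take_length,
      min_eq_left hs, min_eq_left ht, add_assoc]
  intro i j hij hj
  rw [hlen] at hj
  exact key i j hij hj _ _ (hget i (hij.trans hj)) (hget j hj)

/-- Nearest-point projections to a Morse quasi-geodesic are sublinearly contracting. -/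
theorem exists_contraction (hconn : G.Connected) {γ : ℤ → V} (hM : HasMorseProperty G γ)
    {κ : ℝ} (hκ : 0 < κ) : ∃ R : ℕ, ∀ (z w : V) (k l : ℤ), IsNearest G γ z k → IsNearest G γ w l →
      R ≤ G.dist z (γ k) → 2 * G.dist z w ≤ G.dist z (γ k) →
      (G.dist (γ k) (γ l) : ℝ) ≤ κ * G.dist z (γ k) := by
  have hCκ : 18 ≤ (7 + 18 / κ) * κ := by
    rw [add_mul, div_mul_cancel₀ _ hκ.ne']
    linarith
  have hC7 : 7 ≤ 7 + 18 / κ := by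
    have : 0 < 18 / κ := by positivity
    linarith
  obtain ⟨R', hR'⟩ := hM (7 + 18 / κ) 1 (by linarith) one_pos
  obtain ⟨R, hR⟩ := exists_nat_gt (3 * R' / κ)
  refine ⟨R, fun z w k l hz hw hRz hzw => ?_⟩
  by_contra! hfar
  obtain ⟨p, hp⟩ := hconn.exists_walk_length_eq_dist (γ k) z
  obtain ⟨q, hq⟩ := hconn.exists_walk_length_eq_dist (γ l) w
  have hpz : p.length = G.dist z (γ k) := by rw [hp, SimpleGraph.dist_comm]
  rw [← hpz] at hzw hfar hRz
  classical
  -- The endpoints `z`, `w` already satisfy the closeness condition. At the first such `s`, the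
  -- Morse property forces `s ≤ R'`, so `d(γ k, γ l) ≤ 3s` is too small.
  have hex : ∃ s, s ≤ p.length ∧ ∃ t ≤ q.length, 2 * G.dist (p.getVert s) (q.getVert t) ≤ s :=
    ⟨p.length, le_rfl, q.length, le_rfl, by rwa [p.getVert_length, q.getVert_length]⟩
  obtain ⟨s, hs, hfirst⟩ : ∃ s, (s ≤ p.length ∧
      ∃ t ≤ q.length, 2 * G.dist (p.getVert s) (q.getVert t) ≤ s) ∧
      ∀ s' < s, ¬ (s' ≤ p.length ∧
        ∃ t ≤ q.length, 2 * G.dist (p.getVert s') (q.getVert t) ≤ s') :=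
    ⟨Nat.find hex, Nat.find_spec hex, fun s' => Nat.find_min hex⟩
  obtain ⟨hs, t₀, ht₀, hst₀⟩ := hs
  obtain ⟨t, ht, hmin⟩ := Finset.exists_min_image (Finset.range (q.length + 1))
    (fun t => G.dist (p.getVert s) (q.getVert t)) ⟨0, by simp⟩
  have ht : t ≤ q.length := by simpa [Nat.lt_succ_iff] using ht
  have hmin : ∀ t' ≤ q.length,
      G.dist (p.getVert s) (q.getVert t) ≤ G.dist (p.getVert s) (q.getVert t') :=
    fun t' ht' => hmin t' (by simpa [Nat.lt_succ_iff] using ht')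
  obtain ⟨m, hm⟩ := hconn.exists_walk_length_eq_dist (p.getVert s) (q.getVert t)
  have hclose : 2 * m.length ≤ s := by
    have := hmin t₀ ht₀
    omega
  have hqg := isQuasiGeodesicWalk_bridge hconn hκ hC7 hCκ hw p hp q hq hfar.le hs ht m hm hclose
    (by rwa [hm]) (fun s' hs' t' ht' => by
      by_contra! h
      exact hfirst s' hs' ⟨by omega, t', ht', h⟩)
  obtain ⟨j, hj⟩ := hR' _ _ _ hqg (p.getVert s) (by
    rw [SimpleGraph.Walk.mem_support_append_iff]
    exact Or.inl (SimpleGraph.Walk.end_mem_support _))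
  have h1 := le_dist_getVert_of_isNearest hconn hz p hp hs j
  have h2 : (s : ℝ) ≤ R' := le_trans (by exact_mod_cast h1) hj
  have h3 := le_dist_getVert_of_isNearest hconn hw q hq ht k
  have h4 := dist_getVert_eq hconn p hp (Nat.zero_le s) hs
  have h5 := dist_getVert_eq hconn q hq (Nat.zero_le t) ht
  rw [p.getVert_zero] at h4
  rw [q.getVert_zero] at h5
  have h6 := hconn.dist_triangle (u := γ k) (v := p.getVert s) (w := γ l)
  have h7 := hconn.dist_triangle (u := p.getVert s) (v := q.getVert t) (w := γ l)
  have h8 := hconn.dist_triangle (u := q.getVert t) (v := p.getVert s) (w := γ k)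
  rw [SimpleGraph.dist_comm (u := q.getVert t) (v := p.getVert s),
    SimpleGraph.dist_comm (u := p.getVert s) (v := γ k)] at h8
  rw [SimpleGraph.dist_comm (u := q.getVert t) (v := γ l)] at h7
  have h9 : G.dist (γ k) (γ l) ≤ 3 * s := by omega
  have h9' : (G.dist (γ k) (γ l) : ℝ) ≤ 3 * s := by exact_mod_cast h9
  have h10 : (R : ℝ) ≤ p.length := by exact_mod_cast hRz
  rw [div_lt_iff₀ hκ] at hR
  nlinarith

/-- Paths which stay far from a Morse quasi-geodesic make little progress along it. -/
theorem exists_dist_proj_le (hconn : G.Connected) {γ : ℤ → V} (hM : HasMorseProperty G γ)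
    {κ : ℝ} (hκ : 0 < κ) : ∃ R₀ : ℕ, ∀ {x y : V} (p : G.Walk x y) (k l : ℤ),
      0 < p.length → IsNearest G γ x k → IsNearest G γ y l →
      (∀ i < p.length, ∀ j, R₀ ≤ G.dist (p.getVert i) (γ j)) →
      (G.dist (γ k) (γ l) : ℝ) ≤ κ * (3 * p.length + 2 * G.dist y (γ l)) := by
  obtain ⟨R, hR⟩ := exists_contraction hconn hM hκ
  -- Distance at least 2 makes half of it, rounded down, at least a third of it; hence the factor 3.
  refine ⟨max R 2, ?_⟩
  suffices h : ∀ (n : ℕ) {x y : V} (p : G.Walk x y) (k l : ℤ), p.length = n → 0 < p.length →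
      IsNearest G γ x k → IsNearest G γ y l →
      (∀ i < p.length, ∀ j, max R 2 ≤ G.dist (p.getVert i) (γ j)) →
      (G.dist (γ k) (γ l) : ℝ) ≤ κ * (3 * p.length + 2 * G.dist y (γ l)) from
    fun {_ _} p k l => h _ p k l rfl
  intro n
  induction n using Nat.strong_induction_on with
  | _ n ih =>
    intro x y p k l hn h0 hx hy hfar
    have hx0 := hfar 0 h0 k
    rw [p.getVert_zero] at hx0
    have hRx : R ≤ G.dist x (γ k) := (le_max_left _ _).trans hx0
    have h2x : 2 ≤ G.dist x (γ k) := (le_max_right _ _).trans hx0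
    by_cases hlen : 2 * p.length ≤ G.dist x (γ k)
    · have hd := SimpleGraph.dist_le p
      have h1 := hR x y k l hx hy hRx (by omega)
      have h2 := hconn.dist_triangle (u := x) (v := y) (w := γ l)
      have h3 := hx l
      have h4 : G.dist x (γ k) ≤ 3 * p.length + 2 * G.dist y (γ l) := by omega
      have h4' : (G.dist x (γ k) : ℝ) ≤ 3 * p.length + 2 * G.dist y (γ l) := by exact_mod_cast h4
      exact h1.trans (mul_le_mul_of_nonneg_left h4' hκ.le)
    -- Cut off the longest initial piece to which the contraction applies, and recurse on the rest.
    · obtain ⟨m, hm⟩ : ∃ m, m = G.dist x (γ k) / 2 := ⟨_, rfl⟩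
      obtain ⟨j, hj⟩ := exists_isNearest G γ (p.getVert m)
      have hd := dist_getVert_le p (Nat.zero_le m)
      rw [p.getVert_zero] at hd
      have h1 := hR x (p.getVert m) k j hx hj hRx (by omega)
      have hdl : (p.drop m).length = p.length - m := SimpleGraph.Walk.drop_length _ _
      have h2 := ih (p.length - m) (by omega) (p.drop m) j l hdl (by omega) hj hy (fun i hi j => by
        rw [SimpleGraph.Walk.drop_getVert]
        exact hfar _ (by omega) j)
      have h3 := hconn.dist_triangle (u := γ k) (v := γ j) (w := γ l)
      have h3' : (G.dist (γ k) (γ l) : ℝ) ≤ G.dist (γ k) (γ j) + G.dist (γ j) (γ l) := by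
        exact_mod_cast h3
      have h4 : G.dist x (γ k) ≤ 3 * m := by omega
      have h4' : (G.dist x (γ k) : ℝ) ≤ 3 * m := by exact_mod_cast h4
      rw [hdl, Nat.cast_sub (by omega)] at h2
      nlinarith

end Geometry

/-! ### Walk lengths, the first-passage metric and its geodesics. -/

section Length

variable {V : Type*} {G : SimpleGraph V}

/-- The list of edges of a walk, as elements of `G.edgeSet`. -/
def edgeList {x y : V} (p : G.Walk x y) : List G.edgeSet :=
  p.darts.map fun d => ⟨d.edge, d.edge_mem⟩

theorem walkLength_eq_edgeList (ω : G.edgeSet → ℝ≥0) {x y : V} (p : G.Walk x y) :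
    walkLength ω p = ((edgeList p).map ω).sum := by
  rw [walkLength, edgeList, List.map_map]
  rfl

theorem length_edgeList {x y : V} (p : G.Walk x y) : (edgeList p).length = p.length := by
  rw [edgeList, List.length_map, SimpleGraph.Walk.length_darts]

theorem nodup_edgeList {x y : V} {p : G.Walk x y} (hp : p.IsTrail) : (edgeList p).Nodup := by
  have h : ((edgeList p).map Subtype.val) = p.edges := by
    rw [edgeList, List.map_map]
    rfl
  exact List.Nodup.of_map Subtype.val (h ▸ hp.edges_nodup)

variable (ω : G.edgeSet → ℝ≥0)

@[simp]
theorem walkLength_nil (x : V) : walkLength ω (SimpleGraph.Walk.nil : G.Walk x x) = 0 := rfl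

@[simp]
theorem walkLength_cons {x y z : V} (h : G.Adj x y) (p : G.Walk y z) :
    walkLength ω (SimpleGraph.Walk.cons h p) = ω ⟨s(x, y), h⟩ + walkLength ω p := by
  simp [walkLength]

@[simp]
theorem walkLength_append {x y z : V} (p : G.Walk x y) (q : G.Walk y z) :
    walkLength ω (p.append q) = walkLength ω p + walkLength ω q := by
  simp [walkLength]

theorem walkLength_reverse {x y : V} (p : G.Walk x y) :
    walkLength ω p.reverse = walkLength ω p := by
  induction p with
  | nil => rfl
  | cons h p ih =>
    rw [SimpleGraph.Walk.reverse_cons, walkLength_append, ih, walkLength_cons, walkLength_cons,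
      walkLength_nil, add_zero, add_comm]
    congr 2
    exact Subtype.ext Sym2.eq_swap

theorem walkLength_pos {ω : G.edgeSet → ℝ≥0} (hω : ∀ e, 0 < ω e) {x y : V} (p : G.Walk x y)
    (hp : 0 < p.length) : 0 < walkLength ω p := by
  cases p with
  | nil => simp at hp
  | cons h p =>
    rw [walkLength_cons]
    exact add_pos_of_pos_of_nonneg (hω _) zero_le

theorem fppDist_le {x y : V} (p : G.Walk x y) : fppDist ω x y ≤ walkLength ω p :=
  ciInf_le (OrderBot.bddBelow _) p

theorem fppDist_self (x : V) : fppDist ω x x = 0 :=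
  le_antisymm (fppDist_le ω SimpleGraph.Walk.nil) zero_le

theorem fppDist_le_of_adj {x y : V} (h : G.Adj x y) : fppDist ω x y ≤ ω ⟨s(x, y), h⟩ := by
  simpa using fppDist_le ω (SimpleGraph.Walk.cons h SimpleGraph.Walk.nil)

/-- Connectedness matters: an infimum over no walks is `0` in `ℝ≥0`. -/
theorem fppDist_triangle (hconn : G.Connected) (x y z : V) :
    fppDist ω x z ≤ fppDist ω x y + fppDist ω y z := by
  have : Nonempty (G.Walk x y) := hconn.preconnected x y
  have : Nonempty (G.Walk y z) := hconn.preconnected y z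
  exact NNReal.le_iInf_add_iInf fun p q => by
    simpa using fppDist_le ω (p.append q)

theorem fppDist_comm (x y : V) : fppDist ω x y = fppDist ω y x :=
  Equiv.iInf_congr ⟨SimpleGraph.Walk.reverse, SimpleGraph.Walk.reverse,
    SimpleGraph.Walk.reverse_reverse, SimpleGraph.Walk.reverse_reverse⟩
    fun p => walkLength_reverse ω p

theorem IsGeodesic.append {x y z : V} {p : G.Walk x y} {q : G.Walk y z}
    (h : IsGeodesic ω (p.append q)) : IsGeodesic ω p ∧ IsGeodesic ω q := by
  have h0 : walkLength ω p + walkLength ω q = fppDist ω x z := by rw [← walkLength_append]; exact h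
  constructor
  · refine le_antisymm ?_ (fppDist_le ω p)
    have : Nonempty (G.Walk x y) := ⟨p⟩
    refine le_ciInf fun p' => ?_
    have := fppDist_le ω (p'.append q)
    rw [walkLength_append, ← h0] at this
    exact le_of_add_le_add_right this
  · refine le_antisymm ?_ (fppDist_le ω q)
    have : Nonempty (G.Walk y z) := ⟨q⟩
    refine le_ciInf fun q' => ?_
    have := fppDist_le ω (p.append q')
    rw [walkLength_append, ← h0] at this
    exact le_of_add_le_add_left this

theorem IsGeodesic.reverse {x y : V} {p : G.Walk x y} (h : IsGeodesic ω p) :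
    IsGeodesic ω p.reverse := by
  rw [IsGeodesic, walkLength_reverse, fppDist_comm]
  exact h

theorem IsGeodesic.drop {x y : V} {p : G.Walk x y} (h : IsGeodesic ω p) (n : ℕ) :
    IsGeodesic ω (p.drop n) := by
  rw [← SimpleGraph.Walk.append_take_drop_eq p n] at h
  exact (IsGeodesic.append ω h).2

theorem IsGeodesic.take {x y : V} {p : G.Walk x y} (h : IsGeodesic ω p) (n : ℕ) :
    IsGeodesic ω (p.take n) := by
  rw [← SimpleGraph.Walk.append_take_drop_eq p n] at h
  exact (IsGeodesic.append ω h).1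

theorem walkLength_take_le {x y : V} (p : G.Walk x y) (n : ℕ) :
    walkLength ω (p.take n) ≤ walkLength ω p := by
  conv_rhs => rw [← SimpleGraph.Walk.append_take_drop_eq p n, walkLength_append]
  exact le_add_of_nonneg_right zero_le

theorem walkLength_dropUntil_le [DecidableEq V] {x y u : V} (p : G.Walk x y) (hu : u ∈ p.support) :
    walkLength ω (p.dropUntil u hu) ≤ walkLength ω p := by
  conv_rhs => rw [← SimpleGraph.Walk.take_spec p hu, walkLength_append]
  exact le_add_of_nonneg_left zero_le

theorem exists_isPath_walkLength_le {x y : V} (p : G.Walk x y) :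
    ∃ q : G.Walk x y, q.IsPath ∧ walkLength ω q ≤ walkLength ω p := by
  classical
  induction p with
  | nil => exact ⟨SimpleGraph.Walk.nil, SimpleGraph.Walk.IsPath.nil, le_rfl⟩
  | @cons x _ _ h p ih =>
    obtain ⟨q, hq, hqp⟩ := ih
    rw [walkLength_cons]
    by_cases hx : x ∈ q.support
    · exact ⟨q.dropUntil x hx, hq.dropUntil hx, (walkLength_dropUntil_le ω q hx).trans
        (hqp.trans (le_add_of_nonneg_left zero_le))⟩
    · refine ⟨SimpleGraph.Walk.cons h q, (SimpleGraph.Walk.cons_isPath_iff h q).2 ⟨hq, hx⟩, ?_⟩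
      rw [walkLength_cons]
      gcongr

/-- A repeated vertex would bound a geodesic loop, of `ω`-length zero, against positivity. Paths are
trails, so linear growth applies to geodesics. -/
theorem IsGeodesic.isPath {ω : G.edgeSet → ℝ≥0} (hω : ∀ e, 0 < ω e) {x y : V} {p : G.Walk x y}
    (h : IsGeodesic ω p) : p.IsPath := by
  rw [← SimpleGraph.Walk.IsPath.getVert_injOn_iff]
  suffices H : ∀ i j, i < j → j ≤ p.length → p.getVert i ≠ p.getVert j by
    intro i hi j hj hij
    rcases lt_trichotomy i j with hlt | heq | hlt
    · exact absurd hij (H i j hlt hj)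
    · exact heq
    · exact absurd hij.symm (H j i hlt hi)
  intro i j hij hj heq
  have h1 := (h.drop ω i).take ω (j - i)
  have h2 : (p.drop i).getVert (j - i) = p.getVert i := by
    rw [SimpleGraph.Walk.drop_getVert, Nat.add_sub_cancel' hij.le, heq]
  have h3 := walkLength_pos hω ((p.drop i).take (j - i)) (by
    rw [SimpleGraph.Walk.take_length, SimpleGraph.Walk.drop_length]
    omega)
  have h4 : fppDist ω (p.getVert i) ((p.drop i).getVert (j - i)) = 0 := by
    rw [h2, fppDist_self]
  rw [IsGeodesic] at h1
  rw [h1, h4] at h3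
  exact lt_irrefl _ h3

/-- The weight of a pair of vertices: the length of the edge joining them, if there is one. -/
noncomputable def pairWeight (x y : V) : ℝ≥0 :=
  open Classical in if h : G.Adj x y then ω ⟨s(x, y), h⟩ else 0

theorem pairWeight_of_adj {x y : V} (h : G.Adj x y) : pairWeight ω x y = ω ⟨s(x, y), h⟩ :=
  dif_pos h

theorem walkLength_eq_sum {x y : V} (p : G.Walk x y) :
    walkLength ω p =
      ∑ i ∈ Finset.range p.length, pairWeight ω (p.getVert i) (p.getVert (i + 1)) := by
  induction p with
  | nil => rfl
  | cons h p ih =>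
    rw [walkLength_cons, SimpleGraph.Walk.length_cons, Finset.sum_range_succ', add_comm]
    congr 1
    simp only [SimpleGraph.Walk.getVert_cons_succ, SimpleGraph.Walk.getVert_zero]
    exact (pairWeight_of_adj ω h).symm

/-- Geodesicity in terms of vertices alone, the form that survives a pointwise limit. -/
theorem IsGeodesic.sum_pairWeight {x y : V} {p : G.Walk x y} (h : IsGeodesic ω p) {i j : ℕ}
    (hij : i ≤ j) (hj : j ≤ p.length) :
    ∑ k ∈ Finset.range (j - i), pairWeight ω (p.getVert (i + k)) (p.getVert (i + k + 1)) =
      fppDist ω (p.getVert i) (p.getVert j) := by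
  have h1 := (h.drop ω i).take ω (j - i)
  rw [IsGeodesic, walkLength_eq_sum, SimpleGraph.Walk.take_length, SimpleGraph.Walk.drop_length,
    min_eq_left (by omega)] at h1
  have h2 : (p.drop i).getVert (j - i) = p.getVert j := by
    rw [SimpleGraph.Walk.drop_getVert, Nat.add_sub_cancel' hij]
  rw [← h2, ← h1]
  refine Finset.sum_congr rfl fun k hk => ?_
  rw [Finset.mem_range] at hk
  rw [SimpleGraph.Walk.take_getVert, SimpleGraph.Walk.take_getVert, min_eq_right hk.le,
    min_eq_right hk, SimpleGraph.Walk.drop_getVert, SimpleGraph.Walk.drop_getVert, add_assoc]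

theorem fppDist_path_le (hconn : G.Connected) {β : ℕ → V} (hβ : ∀ n, G.Adj (β n) (β (n + 1)))
    (n : ℕ) : fppDist ω (β 0) (β n) ≤ ∑ i ∈ Finset.range n, ω ⟨s(β i, β (i + 1)), hβ i⟩ := by
  induction n with
  | zero => simp [fppDist_self]
  | succ n ih =>
    rw [Finset.sum_range_succ]
    exact (fppDist_triangle ω hconn _ (β n) _).trans
      (add_le_add ih (fppDist_le_of_adj ω (hβ n)))

end Length

/-! ### Counting walks and vertices in a graph of bounded degree. -/

section Counting

variable {V : Type*} {G : SimpleGraph V}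

theorem BoundedDegree.exists_finset (h : BoundedDegree G) :
    ∃ (q : ℕ) (N : V → Finset V), (∀ v, (N v).card ≤ q) ∧ ∀ v w, w ∈ N v ↔ G.Adj v w := by
  obtain ⟨q, hq⟩ := h
  have hfin : ∀ v, (G.neighborSet v).Finite := fun v =>
    Set.encard_lt_top_iff.1 ((hq v).trans_lt (ENat.natCast_lt_top q))
  refine ⟨q, fun v => (hfin v).toFinset, fun v => ?_, fun v w => by simp⟩
  have := hq v
  rw [(hfin v).encard_eq_coe_toFinset_card] at this
  exact_mod_cast this

variable {q : ℕ} {N : V → Finset V}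

/-- Edge lists put walks with different endpoints into a single type, as the union bounds require.
-/
theorem exists_finset_edgeList (hq : ∀ v, (N v).card ≤ q) (hN : ∀ v w, w ∈ N v ↔ G.Adj v w)
    (n : ℕ) (x : V) : ∃ F : Finset (List G.edgeSet), F.card ≤ q ^ n ∧
      ∀ (y : V) (p : G.Walk x y), p.length = n → edgeList p ∈ F := by
  classical
  induction n generalizing x with
  | zero =>
    refine ⟨{[]}, by simp, fun y p hp => ?_⟩
    cases p with
    | nil => simp [edgeList]
    | cons h p => simp at hp
  | succ n ih =>
    choose F hF hpF using ih
    refine ⟨(N x).attach.biUnion fun w =>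
      (F w).image (List.cons ⟨s(x, w), (hN x w).1 w.2⟩), ?_, fun y p hp => ?_⟩
    · refine Finset.card_biUnion_le.trans ?_
      calc ∑ w ∈ (N x).attach, ((F w).image (List.cons ⟨s(x, w), (hN x w).1 w.2⟩)).card
          ≤ ∑ w ∈ (N x).attach, q ^ n :=
            Finset.sum_le_sum fun w _ => Finset.card_image_le.trans (hF w)
        _ ≤ q ^ (n + 1) := by
            rw [Finset.sum_const, Finset.card_attach, smul_eq_mul, pow_succ, mul_comm]
            exact Nat.mul_le_mul_left _ (hq x)
    · cases p with
      | nil => simp at hp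
      | @cons _ w _ h p =>
        rw [Finset.mem_biUnion]
        refine ⟨⟨w, (hN x w).2 h⟩, Finset.mem_attach _ _, Finset.mem_image.2
          ⟨edgeList p, hpF w y p (by simpa using hp), ?_⟩⟩
        simp [edgeList]

theorem exists_finset_ball (hconn : G.Connected) (hq : ∀ v, (N v).card ≤ q)
    (hN : ∀ v w, w ∈ N v ↔ G.Adj v w) (n : ℕ) (x : V) :
    ∃ F : Finset V, F.card ≤ (q + 1) ^ n ∧ ∀ y, G.dist x y ≤ n → y ∈ F := by
  classical
  induction n with
  | zero =>
    refine ⟨{x}, by simp, fun y hy => ?_⟩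
    rw [Nat.le_zero, hconn.dist_eq_zero_iff] at hy
    simp [hy]
  | succ n ih =>
    obtain ⟨F, hF, hxF⟩ := ih
    refine ⟨F ∪ F.biUnion N, ?_, fun y hy => ?_⟩
    · refine (Finset.card_union_le _ _).trans ?_
      have h1 : (F.biUnion N).card ≤ F.card * q := Finset.card_biUnion_le_card_mul _ _ _ fun v _ => hq v
      calc F.card + (F.biUnion N).card ≤ F.card + F.card * q := by omega
        _ = F.card * (q + 1) := by ring
        _ ≤ (q + 1) ^ (n + 1) := by
          rw [pow_succ]
          exact Nat.mul_le_mul_right _ hF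
    · rw [Finset.mem_union]
      rcases Nat.lt_or_ge n (G.dist x y) with h | h
      · right
        obtain ⟨p, hp⟩ := hconn.exists_walk_length_eq_dist x y
        have h1 := dist_getVert_le p (Nat.zero_le n)
        rw [p.getVert_zero] at h1
        refine Finset.mem_biUnion.2 ⟨p.getVert n, hxF _ (by omega), ?_⟩
        rw [hN]
        have h2 := p.adj_getVert_succ (i := n) (by omega)
        rwa [show n + 1 = p.length by omega, p.getVert_length] at h2
      · exact Or.inl (hxF y h)

theorem BoundedDegree.finite_ball (hdeg : BoundedDegree G) (hconn : G.Connected) (x : V) (n : ℕ) :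
    {y | G.dist x y ≤ n}.Finite := by
  obtain ⟨q, N, hq, hN⟩ := hdeg.exists_finset
  obtain ⟨F, -, hF⟩ := exists_finset_ball hconn hq hN n x
  exact F.finite_toSet.subset hF

theorem BoundedDegree.countable (hdeg : BoundedDegree G) (hconn : G.Connected) : Countable V := by
  obtain ⟨x⟩ := hconn.nonempty
  rw [← Set.countable_univ_iff]
  refine (Set.countable_iUnion fun n : ℕ => (hdeg.finite_ball hconn x n).countable).mono ?_
  exact fun y _ => Set.mem_iUnion.2 ⟨G.dist x y, le_refl (G.dist x y)⟩

end Counting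

/-- Every long trail issuing from a vertex `u`, which is not too far from the base point `o`, has
`ω`-length at least `c` times its combinatorial length. -/
def LinearGrowth {V : Type*} {G : SimpleGraph V} (o : V) (c : ℝ≥0) (ω : G.edgeSet → ℝ≥0) : Prop :=
  ∃ n₀ : ℕ, ∀ n ≥ n₀, ∀ x y : V, G.dist o x ≤ n → ∀ p : G.Walk x y, p.IsTrail → p.length = n →
    c * n ≤ walkLength ω p

/-- Beyond some length every path is `ω`-longer than a fixed walk `p₀`, so only finitely many walks
compete for the infimum. -/
theorem LinearGrowth.exists_isGeodesic {V : Type*} {G : SimpleGraph V} (hconn : G.Connected)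
    (hdeg : BoundedDegree G) {o : V} {c : ℝ≥0} (hc : 0 < c) {ω : G.edgeSet → ℝ≥0}
    (hω : LinearGrowth o c ω) (x y : V) : ∃ p : G.Walk x y, IsGeodesic ω p := by
  classical
  obtain ⟨q, N, hq, hN⟩ := hdeg.exists_finset
  obtain ⟨n₀, hn₀⟩ := hω
  obtain ⟨p₀⟩ := hconn.preconnected x y
  obtain ⟨n₁, hn₁⟩ := exists_nat_gt (walkLength ω p₀ / c)
  obtain ⟨n, hn⟩ : ∃ n, n = n₀ + n₁ + G.dist o x + p₀.length + 1 := ⟨_, rfl⟩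
  choose F hFcard hF using fun n => exists_finset_edgeList hq hN n x
  have hfin : {t | ∃ p : G.Walk x y, p.length < n ∧ walkLength ω p = t}.Finite := by
    refine (((Finset.range n).biUnion F).image fun l => (l.map ω).sum).finite_toSet.subset ?_
    rintro _ ⟨p, hp, rfl⟩
    rw [walkLength_eq_edgeList]
    exact Finset.mem_coe.2 (Finset.mem_image_of_mem _ (Finset.mem_biUnion.2
      ⟨p.length, Finset.mem_range.2 hp, hF _ _ _ rfl⟩))
  obtain ⟨t, ⟨p, hp, rfl⟩, hmin⟩ := Set.exists_min_image _ id hfin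
    ⟨_, p₀, by omega, rfl⟩
  refine ⟨p, le_antisymm ?_ (fppDist_le ω p)⟩
  have : Nonempty (G.Walk x y) := ⟨p⟩
  refine le_ciInf fun p' => ?_
  obtain ⟨p'', hpath, hle⟩ := exists_isPath_walkLength_le ω p'
  refine le_trans ?_ hle
  by_cases hlen : p''.length < n
  · exact hmin _ ⟨p'', hlen, rfl⟩
  · have h1 : walkLength ω p ≤ walkLength ω p₀ := hmin _ ⟨p₀, by omega, rfl⟩
    refine h1.trans (le_trans ?_ (walkLength_take_le ω p'' n))
    refine le_trans ?_ (hn₀ n (by omega) _ _ (by omega) (p''.take n) (hpath.take n).isTrail (by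
      rw [SimpleGraph.Walk.take_length]
      omega))
    rw [div_lt_iff₀ hc] at hn₁
    refine hn₁.le.trans ?_
    rw [mul_comm]
    gcongr
    omega

theorem integrable_coe {ν : Measure ℝ≥0} (hmean : ∫⁻ t, (t : ℝ≥0∞) ∂ν < ∞) :
    Integrable (fun t : ℝ≥0 => (t : ℝ)) ν := by
  refine ⟨by fun_prop, ?_⟩
  rw [hasFiniteIntegral_iff_ofReal (ae_of_all _ fun t => t.2)]
  simpa using hmean

/-! ### Independent edge lengths: Chernoff bound, tail sums, law of large numbers. -/

section Product

variable {E : Type*} (ν : Measure ℝ≥0) [IsProbabilityMeasure ν]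

theorem measurePreserving_eval (e : E) :
    MeasurePreserving (fun ω : E → ℝ≥0 => ω e) (Measure.infinitePi fun _ : E => ν) ν :=
  measurePreserving_eval_infinitePi (fun _ : E => ν) e

theorem ae_forall_pos [Countable E] (hzero : ν {0} = 0) :
    ∀ᵐ ω ∂(Measure.infinitePi fun _ : E => ν), ∀ e, 0 < ω e := by
  rw [ae_all_iff]
  intro e
  have h : ∀ᵐ t ∂ν, 0 < t := by
    rw [ae_iff]
    convert hzero using 2
    ext t
    simp
  exact (measurePreserving_eval ν e).quasiMeasurePreserving.ae h

theorem identDistrib_coe_eval (e : E) :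
    ProbabilityTheory.IdentDistrib (fun ω : E → ℝ≥0 => (ω e : ℝ)) (fun t : ℝ≥0 => (t : ℝ))
      (Measure.infinitePi fun _ : E => ν) ν where
  aemeasurable_fst := Measurable.aemeasurable (by fun_prop)
  aemeasurable_snd := by fun_prop
  map_eq := by
    have h := Measure.map_map (g := fun t : ℝ≥0 => (t : ℝ)) (by fun_prop)
      (measurePreserving_eval ν e).measurable (μ := Measure.infinitePi fun _ : E => ν)
    rw [(measurePreserving_eval ν e).map_eq] at h
    exact h.symm

theorem iIndepFun_coe_eval :
    ProbabilityTheory.iIndepFun (fun (e : E) (ω : E → ℝ≥0) => (ω e : ℝ))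
      (Measure.infinitePi fun _ : E => ν) :=
  ProbabilityTheory.iIndepFun_infinitePi (P := fun _ : E => ν) (X := fun _ (t : ℝ≥0) => (t : ℝ))
    (fun _ => by fun_prop)

/-- Dominated convergence: `exp (-n * t) → 0` for `t ≠ 0`, that is, `ν`-almost everywhere. -/
theorem tendsto_mgf_neg (hzero : ν {0} = 0) :
    Tendsto (fun n : ℕ => ProbabilityTheory.mgf (fun t : ℝ≥0 => (t : ℝ)) ν (-(n : ℝ))) atTop
      (nhds 0) := by
  have h : Tendsto (fun n : ℕ => ∫ t : ℝ≥0, Real.exp (-(n : ℝ) * t) ∂ν) atTop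
      (nhds (∫ _ : ℝ≥0, (0 : ℝ) ∂ν)) := by
    refine tendsto_integral_of_dominated_convergence (fun _ => 1) (fun n => by fun_prop)
      (integrable_const _) (fun n => ae_of_all _ fun t => ?_) ?_
    · rw [Real.norm_eq_abs, Real.abs_exp, Real.exp_le_one_iff]
      have : (0 : ℝ) ≤ n * t := by positivity
      linarith
    · have hpos : ∀ᵐ t ∂ν, t ≠ 0 := by
        rw [ae_iff]
        convert hzero using 2
        ext t
        simp
      filter_upwards [hpos] with t ht
      have ht' : (0 : ℝ) < t := by positivity
      refine Real.tendsto_exp_atBot.comp ?_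
      simp only [neg_mul]
      exact tendsto_neg_atTop_atBot.comp (tendsto_natCast_atTop_atTop.atTop_mul_const ht')
  simpa [ProbabilityTheory.mgf] using h

/-- Chernoff bound: sums of `n` independent lengths are unlikely to be less than `c * n`. -/
theorem exists_measure_sum_lt_le (hzero : ν {0} = 0) {K : ℕ} (hK : 0 < K) :
    ∃ c : ℝ≥0, 0 < c ∧ ∀ l : List E, l.Nodup →
      (Measure.infinitePi fun _ : E => ν) {ω | (l.map ω).sum < c * l.length} ≤
        ((K : ℝ≥0∞)⁻¹) ^ l.length := by
  have hK' : (0 : ℝ) < K := by exact_mod_cast hK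
  have hε : (0 : ℝ) < (Real.exp 1)⁻¹ * (K : ℝ)⁻¹ := by positivity
  -- With `c = 1 / n`, Markov's inequality for `exp (-n * S)` costs a factor `e` per edge; the
  -- choice of `n` leaves `1 / K`.
  obtain ⟨n, hn, hn1⟩ := (((tendsto_mgf_neg ν hzero).eventually_lt_const hε).and
    (eventually_ge_atTop 1)).exists
  have hn0 : (0 : ℝ) < n := by exact_mod_cast hn1
  refine ⟨(n : ℝ≥0)⁻¹, by positivity, fun l hl => ?_⟩
  classical
  set μ := Measure.infinitePi fun _ : E => ν
  have hsum : ∀ ω : E → ℝ≥0, (((l.map ω).sum : ℝ≥0) : ℝ) =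
      (∑ e ∈ l.toFinset, fun ω : E → ℝ≥0 => (ω e : ℝ)) ω := by
    intro ω
    rw [Finset.sum_apply, ← NNReal.coe_sum, List.sum_toFinset _ hl]
  have hmgf : ProbabilityTheory.mgf (∑ e ∈ l.toFinset, fun ω : E → ℝ≥0 => (ω e : ℝ)) μ (-(n : ℝ)) =
      (ProbabilityTheory.mgf (fun t : ℝ≥0 => (t : ℝ)) ν (-(n : ℝ))) ^ l.length := by
    rw [(iIndepFun_coe_eval ν).mgf_sum (fun e => by fun_prop), ← List.toFinset_card_of_nodup hl]
    refine Finset.prod_eq_pow_card fun e _ => ?_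
    exact congrFun (ProbabilityTheory.mgf_congr_identDistrib (identDistrib_coe_eval ν e)) _
  have hint : Integrable (fun ω => Real.exp (-(n : ℝ) *
      (∑ e ∈ l.toFinset, fun ω : E → ℝ≥0 => (ω e : ℝ)) ω)) μ := by
    refine Integrable.of_bound (C := 1) (Measurable.aestronglyMeasurable (by
      simp only [Finset.sum_apply]
      fun_prop)) (ae_of_all _ fun ω => ?_)
    rw [Real.norm_eq_abs, Real.abs_exp, Real.exp_le_one_iff, ← hsum, neg_mul]
    exact neg_nonpos.2 (by positivity)
  have h1 := ProbabilityTheory.measure_le_le_exp_mul_mgf ((n : ℝ)⁻¹ * l.length)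
    (neg_nonpos.2 hn0.le) hint
  have h2 : μ.real {ω | (∑ e ∈ l.toFinset, fun ω : E → ℝ≥0 => (ω e : ℝ)) ω ≤
      (n : ℝ)⁻¹ * l.length} ≤ ((K : ℝ)⁻¹) ^ l.length := by
    refine h1.trans ?_
    rw [hmgf, neg_neg, ← mul_assoc, mul_inv_cancel₀ hn0.ne', one_mul,
      show (l.length : ℝ) = l.length * 1 by ring, Real.exp_nat_mul, ← mul_pow]
    refine pow_le_pow_left₀ (mul_nonneg (Real.exp_pos _).le ProbabilityTheory.mgf_nonneg) ?_ _
    calc Real.exp 1 * ProbabilityTheory.mgf (fun t : ℝ≥0 => (t : ℝ)) ν (-(n : ℝ))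
        ≤ Real.exp 1 * ((Real.exp 1)⁻¹ * (K : ℝ)⁻¹) := by gcongr
      _ = (K : ℝ)⁻¹ := by rw [← mul_assoc, mul_inv_cancel₀ (Real.exp_pos _).ne', one_mul]
  have h3 : {ω : E → ℝ≥0 | (l.map ω).sum < (n : ℝ≥0)⁻¹ * l.length} ⊆
      {ω | (∑ e ∈ l.toFinset, fun ω : E → ℝ≥0 => (ω e : ℝ)) ω ≤ (n : ℝ)⁻¹ * l.length} := by
    intro ω hω
    rw [Set.mem_ofPred_eq, ← hsum]
    have : (l.map ω).sum ≤ (n : ℝ≥0)⁻¹ * l.length := le_of_lt hω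
    have := NNReal.coe_le_coe.2 this
    rwa [NNReal.coe_mul, NNReal.coe_inv, NNReal.coe_natCast, NNReal.coe_natCast] at this
  refine (measure_mono h3).trans ?_
  rw [← ofReal_measureReal]
  refine (ENNReal.ofReal_le_ofReal h2).trans (le_of_eq ?_)
  rw [ENNReal.ofReal_pow (by positivity), ENNReal.ofReal_inv_of_pos hK', ENNReal.ofReal_natCast]

variable {ν} in
theorem tsum_measure_mul_gt_ne_top (hmean : ∫⁻ t, (t : ℝ≥0∞) ∂ν < ∞) (R : ℕ) :
    ∑' k : ℕ, ν {t | (k : ℝ≥0) < R * t} ≠ ∞ := by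
  have h := @ProbabilityTheory.tsum_prob_mem_Ioi_lt_top ℝ≥0 ⟨ν⟩ ‹_›
    (fun t : ℝ≥0 => (R : ℝ) * t) ((integrable_coe hmean).const_mul _)
    (fun t => by positivity)
  have hset : ∀ k : ℕ, {t : ℝ≥0 | (k : ℝ≥0) < R * t} = {t : ℝ≥0 | (R : ℝ) * t ∈ Set.Ioi (k : ℝ)} := by
    intro k
    ext t
    rw [Set.mem_ofPred_eq, Set.mem_ofPred_eq, Set.mem_Ioi]
    norm_cast
  simp_rw [hset]
  exact h.ne

variable {ν} in
/-- Strong law of large numbers along a sequence of edges with bounded returns. -/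
theorem ae_exists_sum_le (hmean : ∫⁻ t, (t : ℝ≥0∞) ∂ν < ∞) {N : ℕ} (hN : 0 < N) (e : ℕ → E)
    (he : ∀ i j, e i = e j → j < i + N) :
    ∀ᵐ ω ∂(Measure.infinitePi fun _ : E => ν), ∃ Z : ℝ, ∀ b : ℕ,
      ∑ i ∈ Finset.range b, (ω (e i) : ℝ) ≤ N * (∫ t, (t : ℝ) ∂ν + 1) * b + Z := by
  set μ := Measure.infinitePi fun _ : E => ν
  -- Indices congruent modulo `N` give distinct, hence independent, edges, so the strong law applies
  -- to each residue class.
  have hlaw : ∀ r < N, ∀ᵐ ω ∂μ, ∃ Z : ℝ, ∀ b : ℕ,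
      ∑ k ∈ Finset.range b, (ω (e (r + N * k)) : ℝ) ≤ (∫ t, (t : ℝ) ∂ν + 1) * b + Z := by
    intro r _
    have hinj : ∀ i j, i ≠ j → e (r + N * i) ≠ e (r + N * j) := by
      intro i j hij h
      have h1 := he _ _ h
      have h2 := he _ _ h.symm
      rcases lt_or_gt_of_ne hij with hlt | hlt
      · have : N * (i + 1) ≤ N * j := Nat.mul_le_mul_left _ hlt
        rw [mul_add, mul_one] at this
        omega
      · have : N * (j + 1) ≤ N * i := Nat.mul_le_mul_left _ hlt
        rw [mul_add, mul_one] at this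
        omega
    have hint : Integrable (fun ω : E → ℝ≥0 => (ω (e (r + N * 0)) : ℝ)) μ :=
      (identDistrib_coe_eval ν _).integrable_iff.2 (integrable_coe hmean)
    have hslln := ProbabilityTheory.strong_law_ae_real
      (fun k (ω : E → ℝ≥0) => (ω (e (r + N * k)) : ℝ)) hint
      (fun i j hij => (iIndepFun_coe_eval ν).indepFun (hinj i j hij))
      (fun i => (identDistrib_coe_eval ν _).trans (identDistrib_coe_eval ν _).symm)
    rw [(identDistrib_coe_eval ν _).integral_eq] at hslln
    filter_upwards [hslln] with ω hω
    obtain ⟨n₀, hn₀⟩ := (hω.eventually_lt_const (lt_add_one _)).exists_forall_of_atTop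
    refine ⟨∑ k ∈ Finset.range n₀, (ω (e (r + N * k)) : ℝ), fun b => ?_⟩
    have hm : (0 : ℝ) ≤ ∫ t : ℝ≥0, (t : ℝ) ∂ν := integral_nonneg fun t => t.2
    have hZ : (0 : ℝ) ≤ ∑ k ∈ Finset.range n₀, (ω (e (r + N * k)) : ℝ) :=
      Finset.sum_nonneg fun _ _ => NNReal.coe_nonneg _
    rcases le_or_gt b n₀ with hb | hb
    · have h1 : ∑ k ∈ Finset.range b, (ω (e (r + N * k)) : ℝ) ≤
          ∑ k ∈ Finset.range n₀, (ω (e (r + N * k)) : ℝ) :=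
        Finset.sum_le_sum_of_subset_of_nonneg (Finset.range_mono hb)
          fun _ _ _ => NNReal.coe_nonneg _
      have h2 : (0 : ℝ) ≤ (∫ t : ℝ≥0, (t : ℝ) ∂ν + 1) * b := by positivity
      linarith
    · have h1 := hn₀ b hb.le
      have hb0 : (0 : ℝ) < b := by exact_mod_cast (Nat.zero_le _).trans_lt hb
      rw [div_lt_iff₀ hb0] at h1
      linarith
  have hall : ∀ᵐ ω ∂μ, ∀ r : ℕ, r < N → ∃ Z : ℝ, ∀ b : ℕ,
      ∑ k ∈ Finset.range b, (ω (e (r + N * k)) : ℝ) ≤ (∫ t, (t : ℝ) ∂ν + 1) * b + Z := by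
    rw [ae_all_iff]
    intro r
    by_cases hr : r < N
    · filter_upwards [hlaw r hr] with ω hω _ using hω
    · exact ae_of_all _ fun ω h => absurd h hr
  filter_upwards [hall] with ω hω
  choose! Z hZ using hω
  refine ⟨∑ r ∈ Finset.range N, Z r, fun b => ?_⟩
  calc ∑ i ∈ Finset.range b, (ω (e i) : ℝ)
      ≤ ∑ i ∈ Finset.range (N * b), (ω (e i) : ℝ) :=
        Finset.sum_le_sum_of_subset_of_nonneg
          (Finset.range_mono (Nat.le_mul_of_pos_left b hN)) fun _ _ _ => NNReal.coe_nonneg _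
    _ = ∑ k ∈ Finset.range b, ∑ r ∈ Finset.range N, (ω (e (r + N * k)) : ℝ) := by
        clear hZ
        induction b with
        | zero => simp
        | succ b ih =>
          rw [mul_add, mul_one, Finset.sum_range_add, ih, Finset.sum_range_succ]
          congr 1
          exact Finset.sum_congr rfl fun r _ => by rw [add_comm]
    _ = ∑ r ∈ Finset.range N, ∑ k ∈ Finset.range b, (ω (e (r + N * k)) : ℝ) := Finset.sum_comm
    _ ≤ ∑ r ∈ Finset.range N, ((∫ t, (t : ℝ) ∂ν + 1) * b + Z r) :=
        Finset.sum_le_sum fun r hr => hZ r (Finset.mem_range.1 hr) b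
    _ = N * (∫ t, (t : ℝ) ∂ν + 1) * b + ∑ r ∈ Finset.range N, Z r := by
        rw [Finset.sum_add_distrib, Finset.sum_const, Finset.card_range, nsmul_eq_mul, mul_assoc]

end Product

/-! ### Almost sure bounds on lengths of trails and on local distances. -/

section Graph

variable {V : Type*} {G : SimpleGraph V} {ν : Measure ℝ≥0} [IsProbabilityMeasure ν]

theorem exists_ae_linearGrowth (hconn : G.Connected) (hdeg : BoundedDegree G) (hzero : ν {0} = 0)
    (o : V) : ∃ c : ℝ≥0, 0 < c ∧ ∀ᵐ ω ∂(edgeLaw G ν), LinearGrowth o c ω := by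
  classical
  obtain ⟨q, N, hq, hN⟩ := hdeg.exists_finset
  -- One factor `q + 1` pays for the starting vertex, one for the trail; the 2 makes the union bound
  -- summable for Borel–Cantelli.
  obtain ⟨K, hK⟩ : ∃ K, K = 2 * ((q + 1) * (q + 1)) := ⟨_, rfl⟩
  have hK0 : 0 < K := by rw [hK]; positivity
  obtain ⟨c, hc, hchern⟩ := exists_measure_sum_lt_le (E := G.edgeSet) ν hzero hK0
  refine ⟨c, hc, ?_⟩
  choose B hBcard hB using fun n => exists_finset_ball hconn hq hN n o
  choose F hFcard hF using fun n => exists_finset_edgeList hq hN n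
  have hbound : ∀ n, edgeLaw G ν {ω | ∃ x ∈ B n, ∃ l ∈ (F n x).filter
      (fun l => l.Nodup ∧ l.length = n), (l.map ω).sum < c * n} ≤ (2⁻¹ : ℝ≥0∞) ^ n := by
    intro n
    have h1 : {ω : G.edgeSet → ℝ≥0 | ∃ x ∈ B n, ∃ l ∈ (F n x).filter
        (fun l => l.Nodup ∧ l.length = n), (l.map ω).sum < c * n} =
        ⋃ x ∈ B n, ⋃ l ∈ (F n x).filter (fun l => l.Nodup ∧ l.length = n),
          {ω | (l.map ω).sum < c * n} := by
      ext ω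
      simp only [Set.mem_ofPred_eq, Set.mem_iUnion, exists_prop]
    rw [h1]
    have h2 : ∀ x, edgeLaw G ν (⋃ l ∈ (F n x).filter (fun l => l.Nodup ∧ l.length = n),
        {ω | (l.map ω).sum < c * n}) ≤ (((q + 1) ^ n : ℕ) : ℝ≥0∞) * ((K : ℝ≥0∞)⁻¹) ^ n := by
      intro x
      refine (measure_biUnion_finset_le _ _).trans ?_
      refine (Finset.sum_le_card_nsmul _ _ (((K : ℝ≥0∞)⁻¹) ^ n) fun l hl => ?_).trans ?_
      · obtain ⟨-, hnd, hlen⟩ := Finset.mem_filter.1 hl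
        have := hchern l hnd
        rw [hlen] at this
        exact this
      · rw [nsmul_eq_mul]
        gcongr
        exact (Finset.card_filter_le _ _).trans ((hFcard n x).trans (Nat.pow_le_pow_left
          (Nat.le_succ q) n))
    refine (measure_biUnion_finset_le _ _).trans ?_
    refine (Finset.sum_le_card_nsmul _ _ _ fun x _ => h2 x).trans ?_
    rw [nsmul_eq_mul, ← mul_assoc, ← Nat.cast_mul]
    calc (((B n).card * (q + 1) ^ n : ℕ) : ℝ≥0∞) * ((K : ℝ≥0∞)⁻¹) ^ n
        ≤ ((((q + 1) * (q + 1)) ^ n : ℕ) : ℝ≥0∞) * ((K : ℝ≥0∞)⁻¹) ^ n := by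
          gcongr
          rw [mul_pow]
          exact Nat.mul_le_mul_right _ (hBcard n)
      _ = (2⁻¹ : ℝ≥0∞) ^ n := by
          rw [Nat.cast_pow, ← mul_pow, hK, Nat.cast_mul 2,
            ENNReal.mul_inv (by simp) (by simp), mul_left_comm,
            ENNReal.mul_inv_cancel (by simp) (ENNReal.natCast_ne_top _), mul_one]
          simp
  have hsum : ∑' n, edgeLaw G ν {ω | ∃ x ∈ B n, ∃ l ∈ (F n x).filter
      (fun l => l.Nodup ∧ l.length = n), (l.map ω).sum < c * n} ≠ ∞ := by
    refine ((ENNReal.tsum_le_tsum hbound).trans_lt ?_).ne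
    rw [ENNReal.tsum_geometric]
    simp
  filter_upwards [ae_eventually_notMem hsum] with ω hω
  obtain ⟨n₀, hn₀⟩ := eventually_atTop.1 hω
  refine ⟨n₀, fun n hn x y hx p hp hlen => ?_⟩
  by_contra! h
  refine hn₀ n hn ⟨x, hB n x hx, edgeList p, Finset.mem_filter.2 ⟨hF n x y p hlen,
    nodup_edgeList hp, (length_edgeList p).trans hlen⟩, ?_⟩
  rwa [← walkLength_eq_edgeList]

/-- Along a sequence of vertices, the `ω`-distance to the `R`-neighbours grows sublinearly. -/
theorem ae_eventually_fppDist_le (hconn : G.Connected) (hdeg : BoundedDegree G)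
    (hmean : ∫⁻ t, (t : ℝ≥0∞) ∂ν < ∞) (g : ℕ → V) (R : ℕ) :
    ∀ᵐ ω ∂(edgeLaw G ν), ∀ᶠ k : ℕ in atTop, ∀ u, G.dist (g k) u ≤ R → fppDist ω (g k) u ≤ k := by
  classical
  obtain ⟨q, N, hq, hN⟩ := hdeg.exists_finset
  choose F hFcard hF using fun n => exists_finset_edgeList hq hN n
  obtain ⟨S, hS⟩ : ∃ S : ℕ → Finset G.edgeSet, S = fun k => (Finset.range (R + 1)).biUnion fun n =>
    ((F n (g k)).filter fun l => l.length = n).biUnion List.toFinset := ⟨_, rfl⟩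
  obtain ⟨Q, hQ⟩ : ∃ Q : ℕ, ∀ k, (S k).card ≤ Q := by
    refine ⟨∑ n ∈ Finset.range (R + 1), q ^ n * n, fun k => ?_⟩
    rw [hS]
    refine Finset.card_biUnion_le.trans (Finset.sum_le_sum fun n _ => ?_)
    refine (Finset.card_biUnion_le_card_mul _ _ n fun l hl => ?_).trans
      (Nat.mul_le_mul_right _ ((Finset.card_filter_le _ _).trans (hFcard n (g k))))
    exact (List.toFinset_card_le l).trans (Finset.mem_filter.1 hl).2.le
  -- If no edge within reach exceeds `k / R`, a walk of at most `R` edges costs at most `k`. The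
  -- number of these edges is bounded uniformly in `k`.
  have hbound : ∀ k : ℕ, edgeLaw G ν (⋃ e ∈ S k, {ω | (k : ℝ≥0) < R * ω e}) ≤
      Q * ν {t | (k : ℝ≥0) < R * t} := by
    intro k
    refine (measure_biUnion_finset_le _ _).trans ?_
    refine (Finset.sum_le_card_nsmul _ _ (ν {t | (k : ℝ≥0) < R * t}) fun e _ => ?_).trans ?_
    · exact ((measurePreserving_eval ν e).measure_preimage
        (measurableSet_lt (by fun_prop) (by fun_prop)).nullMeasurableSet).le
    · rw [nsmul_eq_mul]
      gcongr
      exact hQ k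
  have hsum : ∑' k : ℕ, edgeLaw G ν (⋃ e ∈ S k, {ω | (k : ℝ≥0) < R * ω e}) ≠ ∞ := by
    refine ((ENNReal.tsum_le_tsum hbound).trans_lt ?_).ne
    rw [ENNReal.tsum_mul_left]
    exact ENNReal.mul_lt_top (ENNReal.natCast_lt_top Q) (tsum_measure_mul_gt_ne_top hmean R).lt_top
  filter_upwards [ae_eventually_notMem hsum] with ω hω
  filter_upwards [hω] with k hk u hu
  simp only [Set.mem_iUnion, Set.mem_ofPred_eq, not_exists, not_lt] at hk
  obtain ⟨p, hp⟩ := hconn.exists_walk_length_eq_dist (g k) u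
  refine (fppDist_le ω p).trans ?_
  rcases Nat.eq_zero_or_pos R with hR | hR
  · have h0 : p.length = 0 := by omega
    rw [walkLength_eq_sum, h0]
    simp
  have hR' : (0 : ℝ≥0) < R := by exact_mod_cast hR
  have hedge : ∀ e ∈ edgeList p, ω e ≤ (k : ℝ≥0) / R := by
    intro e he
    rw [le_div_iff₀ hR', mul_comm]
    refine hk e ?_
    rw [hS]
    refine Finset.mem_biUnion.2 ⟨p.length, Finset.mem_range.2 (by omega), Finset.mem_biUnion.2
      ⟨edgeList p, Finset.mem_filter.2 ⟨hF _ _ _ p rfl, length_edgeList p⟩, List.mem_toFinset.2 he⟩⟩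
  rw [walkLength_eq_edgeList]
  have h1 := List.sum_le_card_nsmul ((edgeList p).map ω) ((k : ℝ≥0) / R) (by
    intro t ht
    obtain ⟨e, he, rfl⟩ := List.mem_map.1 ht
    exact hedge e he)
  refine h1.trans ?_
  rw [List.length_map, length_edgeList, nsmul_eq_mul, hp]
  calc (G.dist (g k) u : ℝ≥0) * (k / R) ≤ R * (k / R) := by gcongr
    _ = k := mul_div_cancel₀ _ hR'.ne'

end Graph

/-! ### Geodesics between the two ends of the quasi-geodesic, and their limits. -/

section Crossing

variable {V : Type*} {G : SimpleGraph V}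

theorem IsGeodesic.exists_subwalk {ω : G.edgeSet → ℝ≥0} {x y : V} {p : G.Walk x y}
    (h : IsGeodesic ω p) {s t : ℕ} (hst : s ≤ t) (ht : t ≤ p.length) :
    ∃ w : G.Walk (p.getVert s) (p.getVert t), IsGeodesic ω w ∧ w.length = t - s ∧
      ∀ i ≤ t - s, w.getVert i = p.getVert (s + i) := by
  have h2 : (p.drop s).getVert (t - s) = p.getVert t := by
    rw [SimpleGraph.Walk.drop_getVert, Nat.add_sub_cancel' hst]
  rw [← h2]
  refine ⟨(p.drop s).take (t - s), (h.drop ω s).take ω (t - s), ?_, fun i hi => ?_⟩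
  · rw [SimpleGraph.Walk.take_length, SimpleGraph.Walk.drop_length]
    omega
  · rw [SimpleGraph.Walk.take_getVert, SimpleGraph.Walk.drop_getVert, min_eq_right hi]

/-- If the `ω`-lengths of long trails grow linearly and the `ω`-distance along `γ` is at most
linear, then all `ω`-geodesics joining the two ends of `γ` pass through a ball. -/
theorem exists_forall_isGeodesic_meets_ball (hconn : G.Connected) {γ : ℤ → V}
    (hγ : IsMorseQuasiGeodesic G γ) {c : ℝ≥0} (hc : 0 < c) (L : ℝ≥0) :
    ∃ R : ℕ, ∀ ω : G.edgeSet → ℝ≥0, (∀ e, 0 < ω e) → LinearGrowth (γ 0) c ω →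
      (∀ᶠ k : ℕ in atTop, ∀ u, G.dist (γ k) u ≤ R → fppDist ω (γ 0) u ≤ L * k) →
      (∀ᶠ k : ℕ in atTop, ∀ u, G.dist (γ (-k)) u ≤ R → fppDist ω (γ 0) u ≤ L * k) →
      ∃ r : ℕ, ∀ (i j : ℕ) (p : G.Walk (γ (-i)) (γ j)), IsGeodesic ω p →
        ∃ v ∈ p.support, G.dist (γ 0) v ≤ r := by
  obtain ⟨⟨hpath, C, K, hC, hK, hqg⟩, hM⟩ := hγ
  -- The bound by `c` yields the final contradiction; `δ ≤ 1 / 4` makes the excursion long enough,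
  -- relative to its distance from `γ 0`, for `LinearGrowth`.
  obtain ⟨δ, hδ, hδ4, hδc⟩ : ∃ δ : ℝ, 0 < δ ∧ δ ≤ 1 / 4 ∧ 2 * δ * (L + 1) ≤ c := by
    refine ⟨min (1 / 4) (c / (2 * (L + 1))), by positivity, min_le_left _ _, ?_⟩
    have : min (1 / 4) ((c : ℝ) / (2 * (L + 1))) ≤ c / (2 * (L + 1)) := min_le_right _ _
    rw [le_div_iff₀ (by positivity)] at this
    linarith
  have hC0 : 0 < C := by linarith
  obtain ⟨κ, hκ, hκC⟩ : ∃ κ : ℝ, 0 < κ ∧ C * (κ * 3) = δ := ⟨δ / (3 * C), by positivity, by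
    field_simp⟩
  obtain ⟨R, hR⟩ := exists_dist_proj_le hconn hM hκ
  refine ⟨R, fun ω hω hgrow hright hleft => ?_⟩
  obtain ⟨n₀, hn₀⟩ := hgrow
  obtain ⟨k₁, hk₁⟩ := eventually_atTop.1 hright
  obtain ⟨k₂, hk₂⟩ := eventually_atTop.1 hleft
  obtain ⟨k₃, hk₃⟩ := exists_nat_gt (K + C * (4 * R + 1 + κ * (2 * R)))
  obtain ⟨k, hk⟩ : ∃ k, k = k₁ + k₂ + k₃ + R + n₀ + 1 := ⟨_, rfl⟩
  refine ⟨R + k, fun i j p hp => ?_⟩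
  by_contra! hfar
  have hfar : ∀ n, R + k < G.dist (γ 0) (p.getVert n) := fun n =>
    hfar _ (p.getVert_mem_support n)
  classical
  have hex : ∃ n, ∃ b : ℕ, G.dist (γ b) (p.getVert n) ≤ R :=
    ⟨p.length, j, by rw [p.getVert_length, SimpleGraph.dist_self]; exact Nat.zero_le _⟩
  -- The excursion runs from the last visit, before `t`, near the negative half of `γ` to the first
  -- visit `t` near the positive half. Avoiding the ball forces `a, b > k`.
  obtain ⟨t, ht, ⟨b, hb⟩, htmin⟩ : ∃ t ≤ p.length, (∃ b : ℕ, G.dist (γ b) (p.getVert t) ≤ R) ∧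
      ∀ n < t, ¬ ∃ b : ℕ, G.dist (γ b) (p.getVert n) ≤ R :=
    ⟨Nat.find hex, Nat.find_min' hex ⟨j, by
      rw [p.getVert_length, SimpleGraph.dist_self]; exact Nat.zero_le _⟩, Nat.find_spec hex,
      fun n => Nat.find_min hex⟩
  obtain ⟨s, hst, ⟨a, ha⟩, hsmax⟩ : ∃ s ≤ t, (∃ a : ℕ, G.dist (γ (-a)) (p.getVert s) ≤ R) ∧
      ∀ n, s < n → n ≤ t → ¬ ∃ a : ℕ, G.dist (γ (-a)) (p.getVert n) ≤ R :=
    ⟨Nat.findGreatest (fun n => ∃ a : ℕ, G.dist (γ (-a)) (p.getVert n) ≤ R) t,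
      Nat.findGreatest_le t,
      Nat.findGreatest_spec (P := fun n => ∃ a : ℕ, G.dist (γ (-a)) (p.getVert n) ≤ R)
        (Nat.zero_le t) ⟨i, by rw [p.getVert_zero, SimpleGraph.dist_self]; exact Nat.zero_le _⟩,
      fun n h1 h2 => Nat.findGreatest_is_greatest h1 h2⟩
  obtain ⟨w, hw, hwlen, hwget⟩ := hp.exists_subwalk hst ht
  have hγa : G.dist (γ 0) (γ (-a)) ≤ a := by
    have := dist_path_le hconn hpath (-a) a
    rwa [neg_add_cancel, SimpleGraph.dist_comm] at this
  have hγb : G.dist (γ 0) (γ b) ≤ b := by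
    have := dist_path_le hconn hpath 0 b
    rwa [zero_add] at this
  have hak : k < a := by
    have h1 := hconn.dist_triangle (u := γ 0) (v := γ (-a)) (w := p.getVert s)
    have h2 := hfar s
    omega
  have hbk : k < b := by
    have h1 := hconn.dist_triangle (u := γ 0) (v := γ b) (w := p.getVert t)
    have h2 := hfar t
    omega
  have hab : ((a : ℝ) + b) ≤ C * G.dist (γ (-a)) (γ b) + K := by
    have := hqg (-a) b (by omega)
    push_cast at this
    linarith
  have hak' : ((a : ℝ) + b) > 2 * k := by
    have h1 : (k : ℝ) < a := by exact_mod_cast hak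
    have h2 : (k : ℝ) < b := by exact_mod_cast hbk
    linarith
  have hkk : (k : ℝ) = k₁ + k₂ + k₃ + R + n₀ + 1 := by
    rw [hk]
    push_cast
    ring
  have hR0 : (0 : ℝ) ≤ R := Nat.cast_nonneg _
  have hk₁0 : (0 : ℝ) ≤ k₁ := Nat.cast_nonneg _
  have hk₂0 : (0 : ℝ) ≤ k₂ := Nat.cast_nonneg _
  have hn₀0 : (0 : ℝ) ≤ n₀ := Nat.cast_nonneg _
  have hκR : 0 ≤ κ * (2 * R) := by positivity
  have htri1 := hconn.dist_triangle (u := γ (-a)) (v := p.getVert s) (w := γ b)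
  have htri2 := hconn.dist_triangle (u := p.getVert s) (v := p.getVert t) (w := γ b)
  rw [SimpleGraph.dist_comm (u := p.getVert t) (v := γ b)] at htri2
  rcases Nat.lt_or_ge (s + 1) t with hlt | hle
  · have hout : ∀ n < w.length, ∀ l : ℤ, R ≤ G.dist (w.getVert n) (γ l) := by
      have hin : ∀ n, s < n → n < t → ∀ l : ℤ, R + 1 ≤ G.dist (p.getVert n) (γ l) := by
        intro n h1 h2 l
        by_contra! h
        rw [SimpleGraph.dist_comm] at h
        rcases le_total 0 l with hl | hl
        · obtain ⟨l, rfl⟩ := Int.eq_ofNat_of_zero_le hl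
          exact htmin n h2 ⟨l, by omega⟩
        · obtain ⟨l', hl'⟩ := Int.eq_ofNat_of_zero_le (neg_nonneg.2 hl)
          obtain rfl : l = -l' := by omega
          exact hsmax n h1 h2.le ⟨l', by omega⟩
      intro n hn l
      rw [hwget n (by omega)]
      rcases Nat.eq_zero_or_pos n with rfl | hn0
      · have h1 := hin (s + 1) (by omega) hlt l
        have h2 := hconn.dist_triangle (u := p.getVert (s + 1)) (v := p.getVert s) (w := γ l)
        have h3 := dist_getVert_le p (Nat.le_succ s)
        rw [SimpleGraph.dist_comm] at h3
        rw [add_zero]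
        simp only [Nat.succ_eq_add_one] at h3
        omega
      · exact (Nat.le_succ R).trans (hin (s + n) (by omega) (by omega) l)
    obtain ⟨k', hk'⟩ := exists_isNearest G γ (p.getVert s)
    obtain ⟨l', hl'⟩ := exists_isNearest G γ (p.getVert t)
    have h1 := hR w k' l' (by omega) hk' hl' hout
    have h2 := hk' (-a)
    rw [SimpleGraph.dist_comm (v := γ (-a))] at h2
    have h3 := hl' b
    rw [SimpleGraph.dist_comm (v := γ b)] at h3
    have htri3 := hconn.dist_triangle (u := p.getVert s) (v := γ k') (w := γ b)
    have htri4 := hconn.dist_triangle (u := γ k') (v := γ l') (w := γ b)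
    have htri5 := hconn.dist_triangle (u := γ l') (v := p.getVert t) (w := γ b)
    rw [SimpleGraph.dist_comm (u := γ l') (v := p.getVert t),
      SimpleGraph.dist_comm (u := p.getVert t) (v := γ b)] at htri5
    have h4 : G.dist (γ (-a)) (γ b) ≤ 4 * R + G.dist (γ k') (γ l') := by omega
    have h4' : (G.dist (γ (-a)) (γ b) : ℝ) ≤ 4 * R + G.dist (γ k') (γ l') := by exact_mod_cast h4
    have h5 : (G.dist (p.getVert t) (γ l') : ℝ) ≤ R := by exact_mod_cast (h3.trans hb)
    have h6 : (G.dist (γ (-a)) (γ b) : ℝ) ≤ 4 * R + κ * (3 * w.length + 2 * R) := by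
      refine h4'.trans (add_le_add le_rfl (h1.trans (mul_le_mul_of_nonneg_left ?_ hκ.le)))
      linarith
    have h7 : ((a : ℝ) + b) ≤ K + C * (4 * R + κ * (2 * R)) + δ * w.length := by
      have := mul_le_mul_of_nonneg_left h6 hC0.le
      rw [← hκC]
      linarith
    -- The additive constant is below `k₃ ≤ k < (a + b) / 2` and is absorbed on the left.
    have h8 : ((a : ℝ) + b) ≤ 2 * (δ * w.length) := by linarith
    have h9 : 2 * ((a : ℝ) + b) ≤ w.length := by
      have : (0 : ℝ) ≤ w.length := Nat.cast_nonneg _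
      nlinarith
    have h9' : 2 * (a + b) ≤ w.length := by exact_mod_cast h9
    have h10 := hn₀ w.length (by omega) _ _ (by
      have := hconn.dist_triangle (u := γ 0) (v := γ (-a)) (w := p.getVert s)
      omega) w (hw.isPath hω).isTrail rfl
    have h11 : walkLength ω w ≤ L * a + L * b := by
      rw [hw]
      refine (fppDist_triangle ω hconn _ (γ 0) _).trans (add_le_add ?_ ?_)
      · rw [fppDist_comm]
        exact hk₂ a (by omega) _ ha
      · exact hk₁ b (by omega) _ hb
    have h12 : (c : ℝ) * w.length ≤ L * a + L * b := by exact_mod_cast h10.trans h11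
    have hL0 : (0 : ℝ) ≤ L := L.2
    have h13 : (L + 1) * ((a : ℝ) + b) ≤ c * w.length := by
      calc (L + 1) * ((a : ℝ) + b) ≤ (L + 1) * (2 * (δ * w.length)) := by gcongr
        _ = (2 * δ * (L + 1)) * w.length := by ring
        _ ≤ c * w.length := by gcongr
    nlinarith
  -- With no vertex strictly between, `γ (-a)` and `γ b` are within `2 * R + 1`, contradicting the
  -- quasi-geodesic inequality.
  · have h1 := dist_getVert_le p hst
    have h2 : G.dist (γ (-a)) (γ b) ≤ 2 * R + 1 := by omega
    have h2' : (G.dist (γ (-a)) (γ b) : ℝ) ≤ 2 * R + 1 := by exact_mod_cast h2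
    have h3 := mul_le_mul_of_nonneg_left h2' hC0.le
    have h4 : 0 ≤ C * R := by positivity
    have h5 : 0 ≤ C * (κ * (2 * R)) := by positivity
    linarith

/-- A limit of `ω`-geodesics through a ball is a bi-infinite `ω`-geodesic. -/
theorem exists_isBiInfiniteGeodesic (hconn : G.Connected) (hdeg : BoundedDegree G) (o : V) (r : ℕ)
    {ω : G.edgeSet → ℝ≥0} {x y : ℕ → V} (hx : Tendsto (fun n => G.dist o (x n)) atTop atTop)
    (hy : Tendsto (fun n => G.dist o (y n)) atTop atTop)
    (h : ∀ n, ∃ p : G.Walk (x n) (y n), IsGeodesic ω p ∧ ∃ v ∈ p.support, G.dist o v ≤ r) :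
    ∃ β : ℤ → V, IsBiInfiniteGeodesic ω β := by
  choose p hp v hv hvr using h
  have hm : ∀ n, ∃ m, (p n).getVert m = v n ∧ m ≤ (p n).length := fun n =>
    SimpleGraph.Walk.mem_support_iff_exists_getVert.1 (hv n)
  choose m hmv hmlen using hm
  have hm1 : Tendsto m atTop atTop := by
    refine tendsto_atTop.2 fun k => ?_
    filter_upwards [hx.eventually_ge_atTop (r + k)] with n hn
    have h1 := dist_getVert_le (p n) (Nat.zero_le (m n))
    rw [(p n).getVert_zero, hmv, SimpleGraph.dist_comm] at h1
    have h2 := hconn.dist_triangle (u := o) (v := v n) (w := x n)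
    have h3 := hvr n
    omega
  have hm2 : Tendsto (fun n => (p n).length - m n) atTop atTop := by
    refine tendsto_atTop.2 fun k => ?_
    filter_upwards [hy.eventually_ge_atTop (r + k)] with n hn
    have h1 := dist_getVert_le (p n) (hmlen n)
    rw [(p n).getVert_length, hmv] at h1
    have h2 := hconn.dist_triangle (u := o) (v := v n) (w := y n)
    have h3 := hvr n
    omega
  -- Recentred at `v n`, the `k`-th vertex stays in a finite ball, so it is constant along an
  -- ultrafilter, which replaces a diagonal subsequence. Clamping by `toNat` is harmless since `m n
  -- → ∞`.
  have hlim : ∀ k : ℤ, ∃ z, ∀ᶠ n in (hyperfilter ℕ : Filter ℕ),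
      (p n).getVert ((m n : ℤ) + k).toNat = z := by
    intro k
    have hfin := hdeg.finite_ball hconn o (r + k.natAbs)
    have := (Ultrafilter.eventually_exists_mem_iff (f := hyperfilter ℕ)
      (P := fun z n => (p n).getVert ((m n : ℤ) + k).toNat = z) hfin).1
      (Eventually.of_forall fun n => ⟨_, ?_, rfl⟩)
    · obtain ⟨z, -, hz⟩ := this
      exact ⟨z, hz⟩
    · rw [Set.mem_ofPred_eq]
      have h1 := hvr n
      have h2 := hconn.dist_triangle (u := o) (v := v n)
        (w := (p n).getVert ((m n : ℤ) + k).toNat)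
      rcases le_total (m n) ((m n : ℤ) + k).toNat with hle | hle
      · have h3 := dist_getVert_le (p n) hle
        rw [hmv] at h3
        omega
      · have h3 := dist_getVert_le (p n) hle
        rw [hmv, SimpleGraph.dist_comm] at h3
        omega
  choose β hβ using hlim
  have hU : (hyperfilter ℕ : Filter ℕ) ≤ atTop := Nat.hyperfilter_le_atTop
  have hagree : ∀ i j : ℤ, i ≤ j → ∃ n, ∃ i' : ℕ, i' + (j - i).toNat ≤ (p n).length ∧
      ∀ k : ℕ, k ≤ (j - i).toNat → (p n).getVert (i' + k) = β (i + k) := by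
    intro i j hij
    have h1 : ∀ᶠ n in (hyperfilter ℕ : Filter ℕ), ∀ k ∈ Finset.Icc i j,
        (p n).getVert ((m n : ℤ) + k).toNat = β k :=
      (eventually_all_finset _).2 fun k _ => hβ k
    have h2 := hU (hm1.eventually_ge_atTop i.natAbs)
    have h3 := hU (hm2.eventually_ge_atTop j.natAbs)
    obtain ⟨n, ⟨hn1, hn2⟩, hn3⟩ := ((h1.and h2).and h3).exists
    refine ⟨n, ((m n : ℤ) + i).toNat, by have := hmlen n; omega, fun k hk => ?_⟩
    rw [← hn1 (i + k) (Finset.mem_Icc.2 ⟨by omega, by omega⟩)]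
    congr 1
    omega
  have hadj : IsBiInfinitePath G β := by
    intro i
    obtain ⟨n, i', hlen, hget⟩ := hagree i (i + 1) (by omega)
    have h1 := hget 0 (by omega)
    have h2 := hget 1 (by omega)
    have h3 := (p n).adj_getVert_succ (i := i') (by omega)
    rw [add_zero, Nat.cast_zero, add_zero] at h1
    rw [Nat.cast_one] at h2
    rwa [← h1, ← h2]
  refine ⟨β, hadj, fun i j hij => ?_⟩
  obtain ⟨n, i', hlen, hget⟩ := hagree i j hij
  have h1 := (hp n).sum_pairWeight ω (Nat.le_add_right i' (j - i).toNat) hlen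
  rw [hget _ le_rfl, ← add_zero i', hget 0 (Nat.zero_le _), add_zero, Nat.add_sub_cancel_left,
    Nat.cast_zero, add_zero, show i + ((j - i).toNat : ℤ) = j by omega] at h1
  rw [← h1]
  refine Finset.sum_nbij' (fun k => (k - i).toNat) (fun k => i + k) ?_ ?_ ?_ ?_ ?_
  · intro k hk
    rw [Finset.mem_Ico] at hk
    rw [Finset.mem_range]
    omega
  · intro k hk
    rw [Finset.mem_range] at hk
    rw [Finset.mem_Ico]
    omega
  · intro k hk
    rw [Finset.mem_Ico] at hk
    omega
  · intro k _
    omega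
  · intro k hk
    rw [Finset.mem_Ico] at hk
    have h2 := hget (k - i).toNat (by omega)
    have h3 := hget ((k - i).toNat + 1) (by omega)
    rw [show i + ((k - i).toNat : ℤ) = k by omega] at h2
    rw [show i + (((k - i).toNat + 1 : ℕ) : ℤ) = k + 1 by omega, ← add_assoc] at h3
    rw [h2, h3, pairWeight_of_adj ω (hadj k)]

end Crossing

/-! ### Linear distance bounds along the quasi-geodesic and assembly. -/

section Main

variable {V : Type*} {G : SimpleGraph V} {ν : Measure ℝ≥0} [IsProbabilityMeasure ν]

/-- Along a path with bounded returns, the `ω`-distance to the origin grows at most linearly, with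
a rate which does not depend on the width `R` of the neighbourhood. -/
theorem exists_ae_eventually_fppDist_le (hconn : G.Connected) (hdeg : BoundedDegree G)
    (hmean : ∫⁻ t, (t : ℝ≥0∞) ∂ν < ∞) {β : ℕ → V} (hβ : ∀ n, G.Adj (β n) (β (n + 1)))
    {N : ℕ} (hN : 0 < N) (hret : ∀ i j, G.dist (β i) (β j) ≤ 1 → j < i + N) :
    ∃ L : ℝ≥0, ∀ R : ℕ, ∀ᵐ ω ∂(edgeLaw G ν), ∀ᶠ k : ℕ in atTop, ∀ u, G.dist (β k) u ≤ R →
      fppDist ω (β 0) u ≤ L * k := by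
  have hm : (0 : ℝ) ≤ ∫ t : ℝ≥0, (t : ℝ) ∂ν := integral_nonneg fun t => t.2
  have he : ∀ i j, (⟨s(β i, β (i + 1)), hβ i⟩ : G.edgeSet) = ⟨s(β j, β (j + 1)), hβ j⟩ →
      j < i + N := by
    intro i j hij
    refine hret i j ?_
    have h1 : s(β i, β (i + 1)) = s(β j, β (j + 1)) := congrArg Subtype.val hij
    rcases Sym2.eq_iff.1 h1 with ⟨h, -⟩ | ⟨h, -⟩
    · rw [h, SimpleGraph.dist_self]
      exact Nat.zero_le 1
    · rw [h, SimpleGraph.dist_comm, SimpleGraph.dist_eq_one_iff_adj.2 (hβ j)]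
  -- The extra 2 absorbs the constant `Z ≤ k` and the local detour of cost at most `k`, whatever `R`
  -- is.
  obtain ⟨L, hL⟩ : ∃ L : ℝ≥0, (L : ℝ) = N * (∫ t : ℝ≥0, (t : ℝ) ∂ν + 1) + 2 :=
    ⟨⟨_, by positivity⟩, rfl⟩
  refine ⟨L, fun R => ?_⟩
  filter_upwards [ae_exists_sum_le hmean hN _ he,
    ae_eventually_fppDist_le hconn hdeg hmean β R] with ω ⟨Z, hZ⟩ hloc
  filter_upwards [hloc, eventually_ge_atTop ⌈Z⌉₊] with k hk hkZ u hu
  have h1 := (fppDist_triangle ω hconn (β 0) (β k) u).trans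
    (add_le_add (fppDist_path_le ω hconn hβ k) (hk u hu))
  rw [← NNReal.coe_le_coe] at h1 ⊢
  push_cast at h1
  have h2 := hZ k
  have h3 : Z ≤ k := Nat.ceil_le.1 hkZ
  refine h1.trans ?_
  rw [NNReal.coe_mul, NNReal.coe_natCast, hL]
  linarith

theorem tendsto_dist_of_quasiGeodesic {γ : ℤ → V} (hγ : IsBiInfiniteQuasiGeodesic G γ) :
    Tendsto (fun n : ℕ => G.dist (γ 0) (γ n)) atTop atTop ∧
      Tendsto (fun n : ℕ => G.dist (γ 0) (γ (-n))) atTop atTop := by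
  obtain ⟨-, C, K, hC, hK, hqg⟩ := hγ
  have hC0 : 0 < C := by linarith
  have key : ∀ f : ℕ → ℕ, (∀ n : ℕ, (n : ℝ) ≤ C * f n + K) → Tendsto f atTop atTop := by
    intro f hf
    refine tendsto_atTop.2 fun k => ?_
    filter_upwards [eventually_ge_atTop ⌈C * k + K⌉₊] with n hn
    have h1 := Nat.ceil_le.1 hn
    have h2 := hf n
    have h3 : C * k ≤ C * f n := by linarith
    exact_mod_cast le_of_mul_le_mul_left h3 hC0
  constructor
  · refine key _ fun n => ?_
    have := hqg 0 n (by omega)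
    push_cast at this
    linarith
  · refine key _ fun n => ?_
    have := hqg (-n) 0 (by omega)
    rw [SimpleGraph.dist_comm]
    push_cast at this
    linarith

theorem ae_exists_isGeodesic_and_meets_ball (hconn : G.Connected) (hdeg : BoundedDegree G)
    {γ : ℤ → V} (hγ : IsMorseQuasiGeodesic G γ) (hmean : ∫⁻ t, (t : ℝ≥0∞) ∂ν < ∞)
    (hzero : ν {0} = 0) :
    ∀ᵐ ω ∂(edgeLaw G ν), (∀ x y : V, ∃ p : G.Walk x y, IsGeodesic ω p) ∧
      ∃ r : ℕ, ∀ (i j : ℕ) (p : G.Walk (γ (-i)) (γ j)), IsGeodesic ω p →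
        ∃ v ∈ p.support, G.dist (γ 0) v ≤ r := by
  have hcount := hdeg.countable hconn
  obtain ⟨c, hc, hgrow⟩ := exists_ae_linearGrowth hconn hdeg hzero (γ 0)
  obtain ⟨N, hN, hret⟩ : ∃ N : ℕ, 0 < N ∧ ∀ i j : ℤ, G.dist (γ i) (γ j) ≤ 1 → j < i + N := by
    obtain ⟨-, C, K, hC, hK, hqg⟩ := hγ.1
    obtain ⟨N, hN⟩ := exists_nat_gt (C + K)
    have hN0 : (0 : ℝ) < N := by linarith
    refine ⟨N, by exact_mod_cast hN0, fun i j hij => ?_⟩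
    rcases lt_or_ge j i with h | h
    · omega
    · have h1 := hqg i j h
      have h2 : (G.dist (γ i) (γ j) : ℝ) ≤ 1 := by exact_mod_cast hij
      have h3 : (j : ℝ) < i + N := by nlinarith
      exact_mod_cast h3
  obtain ⟨L₁, hL₁⟩ := exists_ae_eventually_fppDist_le (ν := ν) hconn hdeg hmean
    (β := fun n : ℕ => γ n) (fun n => by simpa using hγ.1.1 n) hN
    (fun i j hij => by exact_mod_cast hret i j hij)
  obtain ⟨L₂, hL₂⟩ := exists_ae_eventually_fppDist_le (ν := ν) hconn hdeg hmean
    (β := fun n : ℕ => γ (-n)) (fun n => by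
      have h := (hγ.1.1 (-(n + 1 : ℕ))).symm
      rwa [show -((n + 1 : ℕ) : ℤ) + 1 = -n by push_cast; ring] at h) hN
    (fun i j hij => by
      rw [SimpleGraph.dist_comm] at hij
      have := hret _ _ hij
      omega)
  -- Here `R` depends on `c`, `L₁`, `L₂`; the distance bounds are instantiated at this `R` only
  -- afterwards.
  obtain ⟨R, hR⟩ := exists_forall_isGeodesic_meets_ball hconn hγ hc (max L₁ L₂)
  have hpos : ∀ᵐ ω ∂(edgeLaw G ν), ∀ e, 0 < ω e := ae_forall_pos ν hzero
  filter_upwards [hgrow, hL₁ R, hL₂ R, hpos] with ω hω h1 h2 h3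
  refine ⟨hω.exists_isGeodesic hconn hdeg hc, hR ω h3 hω ?_ ?_⟩
  · filter_upwards [h1] with k hk u hu
    refine (hk u hu).trans ?_
    gcongr
    exact le_max_left _ _
  · filter_upwards [h2] with k hk u hu
    have h0 := hk u hu
    simp only [Nat.cast_zero, neg_zero] at h0
    refine h0.trans ?_
    gcongr
    exact le_max_right _ _

end Main

end FPP

theorem theorem1 {V : Type*} [Infinite V] (G : SimpleGraph V) (hconn : G.Connected)
    (hdeg : FPP.BoundedDegree G) (γ : ℤ → V) (hγ : FPP.IsMorseQuasiGeodesic G γ)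
    (ν : Measure ℝ≥0) [IsProbabilityMeasure ν]
    (hmean : ∫⁻ t, (t : ℝ≥0∞) ∂ν < ∞) (hzero : ν {0} = 0) :
    (∀ᵐ ω ∂(FPP.edgeLaw G ν), ∃ β : ℤ → V, FPP.IsBiInfiniteGeodesic ω β) ∧
    (∀ᵐ ω ∂(FPP.edgeLaw G ν), ∃ A : Set V, A.Finite ∧
      ∀ x y : ℕ → V, FPP.GoToInfinityOnOppositeSides γ x y →
        ∀ᶠ n in atTop,
          (∃ p : G.Walk (x n) (y n), FPP.IsGeodesic ω p) ∧
          ∀ p : G.Walk (x n) (y n), FPP.IsGeodesic ω p → ∃ v ∈ p.support, v ∈ A) := by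
  have hmain := FPP.ae_exists_isGeodesic_and_meets_ball (ν := ν) hconn hdeg hγ hmean hzero
  refine ⟨?_, ?_⟩
  · filter_upwards [hmain] with ω ⟨hgeo, r, hr⟩
    obtain ⟨hy, hx⟩ := FPP.tendsto_dist_of_quasiGeodesic hγ.1
    refine FPP.exists_isBiInfiniteGeodesic hconn hdeg (γ 0) r hx hy fun n => ?_
    obtain ⟨p, hp⟩ := hgeo (γ (-n)) (γ n)
    exact ⟨p, hp, hr n n p hp⟩
  · filter_upwards [hmain] with ω ⟨hgeo, r, hr⟩
    refine ⟨_, hdeg.finite_ball hconn (γ 0) r, fun x y hxy => ?_⟩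
    have hcross : ∀ i j : ℤ, i ≤ 0 → 0 ≤ j → ∀ p : G.Walk (γ i) (γ j), FPP.IsGeodesic ω p →
        ∃ v ∈ p.support, G.dist (γ 0) v ≤ r := by
      intro i j hi hj
      obtain ⟨j, rfl⟩ := Int.eq_ofNat_of_zero_le hj
      obtain ⟨i', hi'⟩ := Int.eq_ofNat_of_zero_le (neg_nonneg.2 hi)
      obtain rfl : i = -i' := by omega
      exact hr i' j
    obtain ⟨i, j, hxi, hyj, ⟨hi, hj⟩ | ⟨hi, hj⟩⟩ := hxy
    · filter_upwards [hi.eventually_le_atBot 0, hj.eventually_ge_atTop 0] with n hin hjn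
      refine ⟨hgeo _ _, ?_⟩
      rw [hxi, hyj]
      exact hcross _ _ hin hjn
    · filter_upwards [hi.eventually_ge_atTop 0, hj.eventually_le_atBot 0] with n hin hjn
      refine ⟨hgeo _ _, ?_⟩
      rw [hxi, hyj]
      intro p hp
      obtain ⟨v, hv, hvr⟩ := hcross _ _ hjn hin p.reverse (hp.reverse ω)
      exact ⟨v, by simpa using hv, hvr⟩
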